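/- Let $c>0$ be a real number and $d\ge 0$ an integer. There are constants $a, A, C$, depending only on $c$ and $d$, such that the following holds for all integers $1\le m\le n$ and $k$ with $cm\le k\le m$ and all $0<\varepsilon<1$. There is a randomized algorithm in the MPC model with $m$ machines, each with $M\le A\,n\,(1+\log n)^a$ bits of memory (that is, $\tilde O(n)$, with no dependence on $\varepsilon$), that uses $$T\le C\cdot\frac{1}{\varepsilon^{3}}\cdot\log m\cdot\Bigl(\log\frac1\varepsilon+\log m\Bigr)$$ rounds and such that, for all sets $S_1,\dots,S_m\subseteq\{1,\dots,n\}$, where $S_j$ is initially held by machine $j$ only, with probability at least $1-m^{-d}$ the algorithm outputs $k$ (distinct) indices whose sets cover at least $(1-1/e-\varepsilon)\cdot\mathrm{Opt}$ elements. Here $\mathrm{Opt}$ is the largest number of elements covered by $k$ of the sets $S_1,\dots,S_m$. In this MPC model the machines know $n,m,k,\varepsilon$ and work in synchronous rounds. In each round, every machine tosses $M$ private fair coins, sends to each machine a bit string that is a function of its memory content and its coins in that round, and then replaces its memory content by a function of its old memory content, its coins of the round, and the strings received. Always (on every input and for all coin tosses), no machine receives more than $M$ bits in total in a round, and memory contents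 have $M$ bits. Local computation is not charged. The output is computed by one designated machine from its final memory content. -/

import Mathlib

/-! ### Maximum coverage -/

/-- The number of elements covered by the sets whose indices lie in `F`. -/
def coverage {n m : ℕ} (S : Fin m → Finset (Fin n)) (F : Finset (Fin m)) : ℕ :=
  (F.biUnion S).card

/-- The optimum: the largest number of elements covered by `k` of the sets. -/
def maxCoverage {n m : ℕ} (S : Fin m → Finset (Fin n)) (k : ℕ) : ℕ :=
  (Finset.powersetCard k Finset.univ).sup (coverage S)

/-! ### Massively parallel computation (MPC) -/

/-- The content of a machine's memory of `M` bits. -/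
abbrev MPCMemory (M : ℕ) : Type := Fin M → Bool

/-- The coin tosses of an execution: in each of the `T` rounds each of the `m` machines privately
tosses `M` fair coins. -/
abbrev MPCCoins (m M T : ℕ) : Type := Fin T → Fin m → Fin M → Bool

/-- A randomized MPC algorithm with `T` synchronous rounds on `m` machines with `M` bits of memory
each, for inputs of `m` subsets of an `n`-element universe, the `j`-th of which is given to machine
`j` only. Rounds are counted; local computation is free. Whatever a machine keeps from one round to
the next is kept in its `M` bits of memory. -/
structure MPCAlgorithm (n m M T : ℕ) where
  /-- The initial memory content of machine `j`, computed from its own set only. -/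
  load : Fin m → Finset (Fin n) → MPCMemory M
  /-- `send t j x r i` is the message (a bit string, possibly empty) that machine `j`, having memory
  content `x` and coin tosses `r`, sends to machine `i` in round `t`. -/
  send : Fin T → Fin m → MPCMemory M → (Fin M → Bool) → Fin m → List Bool
  /-- `update t j x r q` is the memory content of machine `j` after round `t` if it had memory
  content `x` and coin tosses `r`, and `q i` is the message received from machine `i`. -/
  update : Fin T → Fin m → MPCMemory M → (Fin M → Bool) → (Fin m → List Bool) → MPCMemory M
  /-- The central machine, which produces the output. -/
  central : Fin m
  /-- The output (a set of indices) as a function of the final memory content of the central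
  machine. -/
  output : MPCMemory M → Finset (Fin m)

namespace MPCAlgorithm

variable {n m M T : ℕ} (P : MPCAlgorithm n m M T)

/-- The messages received by machine `j` in round `t`, by sender, when `σ` gives the memory contents
at the beginning of the round and `r` the coin tosses of the round. -/
def inbox (t : Fin T) (σ : Fin m → MPCMemory M) (r : Fin m → Fin M → Bool) (j : Fin m) :
    Fin m → List Bool :=
  fun i => P.send t i (σ i) (r i) j

/-- The memory contents of all machines at time `t`, that is after `t` rounds, on input `S` with
coin tosses `ω`. -/
def config (S : Fin m → Finset (Fin n)) (ω : MPCCoins m M T) :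
    Fin (T + 1) → Fin m → MPCMemory M :=
  Fin.induction (motive := fun _ => Fin m → MPCMemory M)
    (fun j => P.load j (S j))
    (fun t σ j => P.update t j (σ j) (ω t j) (P.inbox t σ (ω t) j))

/-- On every input, for all outcomes of the coin tosses, no machine receives messages of total size
more than `M` bits in a round. -/
def RespectsBandwidth : Prop :=
  ∀ (S : Fin m → Finset (Fin n)) (ω : MPCCoins m M T) (t : Fin T) (j : Fin m),
    ∑ i, (P.inbox t (P.config S ω t.castSucc) (ω t) j i).length ≤ M

/-- The output of the execution on input `S` with coin tosses `ω`. -/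
def result (S : Fin m → Finset (Fin n)) (ω : MPCCoins m M T) : Finset (Fin m) :=
  P.output (P.config S ω (Fin.last T) P.central)

open Classical in
/-- The probability, over independent fair coin tosses, that the output on input `S` lies in `E`. -/
noncomputable def outputProb (S : Fin m → Finset (Fin n)) (E : Set (Finset (Fin m))) : ℝ :=
  ((Finset.univ.filter fun ω : MPCCoins m M T => P.result S ω ∈ E).card : ℝ) /
    (Fintype.card (MPCCoins m M T) : ℝ)

end MPCAlgorithm

/-!
The algorithm is deterministic; its coins are ignored.

*Communication.* The elements are distributed evenly over the machines. After one round, the machine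
in charge of an element knows all sets that contain it. From then on, a step in which every element
contributes to `m` sums, one per index, and in which the contribution depends on the common state and
on the sets containing the element, takes two rounds: the partial sums are sent to the machine of
the index, and the totals are sent to everybody, so that all machines can update the common state.
This is `ColumnSumProcess.exists_mpcAlgorithm`.

*Small `ε`.* If `ε < 1 / m`, the bound on the number of rounds is at least of the order of `m`, which
leaves room for sequential greedy, see `maxCoverage_le_greedyProcess`.

*Large `ε`.* Let `K ≥ 1 / c`, so that `m ≤ K * k`, and let `q` be about `4 * K / ε`. Averaging shows
that the union of all sets has at most `K * Opt` elements (`mul_card_incidence_nonempty_le`), so an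
error of `O(1 / q)` per element of the union is affordable. An element in more than `D = q ^ 2 * K`
sets is covered with probability at least `1 - 1 / q` by `k / q` uniformly random sets; it gets
weight zero in the optimization. For the remaining elements, the relaxation that maximizes the sum of
`1 - exp (- x e)`, where `x e` is the total weight of the sets containing `e`, is solved by continuous
greedy. Each step adds the `k` best sets with weight `1 / R`, where `R = q * D`. As no element lies in
more than `D` sets, `x e` changes by at most `1 / q` per step, and `R = O(1 / ε ^ 3)` steps suffice to
reach `1 - 1 / e - O(1 / q)` times the optimum (`continuous_greedy`).

*Rounding.* Drawing `k` sets independently from the distribution proportional to `x`, mixed with a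
bit of the uniform distribution, preserves the value. By a Chernoff and union bound over the `2 ^ m`
possible incidence sets of an element, there are `4 * q ^ 2 * m` outcomes, depending on `x` only, the
average of which is as good up to an error `1 / q` for every incidence set (`exists_samples`). All
machines know `x`, hence these outcomes, and evaluate `m` of them in one step, as the `m` sums. The
best one is the output.
-/

/-! ### Column-sum processes and their simulation -/

/-- The indices of the sets that contain the element `e`. -/
def incidence {n m : ℕ} (S : Fin m → Finset (Fin n)) (e : Fin n) : Finset (Fin m) :=
  Finset.univ.filter fun j => e ∈ S j

/-- A deterministic iterative process on a state known to all machines. In step `i` the input is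
consulted through the `m` sums over all elements `e` of `query i s e N j`, where `s` is the state
and `N` is the incidence set of `e`, one sum for every `j : Fin m`. The next state is a function of
the state and of these `m` sums. -/
structure ColumnSumProcess (n m : ℕ) (State : Type) where
  /-- The initial state. -/
  init : State
  /-- The contribution of an element with a given incidence set to the `j`-th sum. -/
  query : ℕ → State → Fin n → Finset (Fin m) → Fin m → ℕ
  /-- The next state. -/
  next : ℕ → State → (Fin m → ℕ) → State

namespace ColumnSumProcess

variable {n m : ℕ} {State : Type} (Q : ColumnSumProcess n m State)

/-- The sums that step `i` obtains in state `s` on input `S`. -/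
def answers (S : Fin m → Finset (Fin n)) (i : ℕ) (s : State) (j : Fin m) : ℕ :=
  ∑ e, Q.query i s e (incidence S e) j

/-- The state before step `i` on input `S`. -/
def run (S : Fin m → Finset (Fin n)) : ℕ → State
  | 0 => Q.init
  | i + 1 => Q.next i (run S i) (Q.answers S i (run S i))

end ColumnSumProcess

/-- A finite set of at most `2 ^ M` objects can be encoded by `M` bits. -/
lemma exists_bit_encoding {X : Type*} [Nonempty X] (s : Finset X) (M : ℕ) (h : s.card ≤ 2 ^ M) :
    ∃ (enc : X → Fin M → Bool) (dec : (Fin M → Bool) → X), ∀ x ∈ s, dec (enc x) = x := by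
  classical
  have hc : Fintype.card s ≤ Fintype.card (Fin M → Bool) := by simpa using h
  obtain ⟨f⟩ := Function.Embedding.nonempty_of_card_le hc
  refine ⟨fun x => if hx : x ∈ s then f ⟨x, hx⟩ else fun _ => false,
    fun y => if hy : ∃ x, f x = y then hy.choose.1 else Classical.arbitrary X, fun x hx => ?_⟩
  have hy : ∃ z, f z = f ⟨x, hx⟩ := ⟨_, rfl⟩
  simp only [hx, dif_pos]
  rw [dif_pos hy, f.injective hy.choose_spec]

/-- The variant of `exists_bit_encoding` for messages: bit strings of length `ℓ`. -/
lemma exists_list_encoding {X : Type*} [Nonempty X] (s : Finset X) (ℓ : ℕ) (h : s.card ≤ 2 ^ ℓ) :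
    ∃ (enc : X → List Bool) (dec : List Bool → X),
      (∀ x, (enc x).length = ℓ) ∧ ∀ x ∈ s, dec (enc x) = x := by
  obtain ⟨enc, dec, hed⟩ := exists_bit_encoding s ℓ h
  refine ⟨fun x => List.ofFn (enc x), fun l => dec fun i => l.getD i false, by simp, ?_⟩
  intro x hx
  have h : (fun i : Fin ℓ => (List.ofFn (enc x)).getD i false) = enc x := by
    funext i
    simp
  simp only [h, hed x hx]

/-- The elements assigned to machine `j`: the residue class of `j` modulo `m`. -/
def block (n : ℕ) {m : ℕ} (j : Fin m) : Finset (Fin n) :=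
  Finset.univ.filter fun e => e.val % m = j.val

lemma mul_card_block_le (n : ℕ) {m : ℕ} (j : Fin m) : m * (block n j).card ≤ n + m := by
  have h : (block n j).card ≤ (Finset.range (n / m + 1)).card := by
    refine Finset.card_le_card_of_injOn (fun e => e.val / m) ?_ ?_
    · intro e _
      simpa [Nat.lt_succ_iff] using Nat.div_le_div_right e.2.le
    · intro e he f hf hef
      simp only [block, Finset.coe_filter, Finset.mem_univ, true_and, Set.mem_ofPred_eq] at he hf
      have h1 := Nat.div_add_mod e.val m
      have h2 := Nat.div_add_mod f.val m
      simp only at hef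
      rw [hef] at h1
      apply Fin.ext
      omega
  rw [Finset.card_range] at h
  calc m * (block n j).card ≤ m * (n / m + 1) := Nat.mul_le_mul_left _ h
    _ = m * (n / m) + m := by ring
    _ ≤ n + m := Nat.add_le_add_right (Nat.mul_div_le n m) m

lemma sum_blocks {n m : ℕ} (hm : 0 < m) (f : Fin n → ℕ) :
    ∑ j : Fin m, ∑ e ∈ block n j, f e = ∑ e, f e := by
  rw [← Finset.sum_fiberwise_of_maps_to (s := Finset.univ) (t := Finset.univ)
    (g := fun e : Fin n => (⟨e.val % m, Nat.mod_lt _ hm⟩ : Fin m)) (by simp)]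
  refine Finset.sum_congr rfl fun j _ => Finset.sum_congr ?_ fun _ _ => rfl
  ext e
  simp [block, Fin.ext_iff]

namespace ColumnSumProcess

variable {n m : ℕ} {State : Type} (Q : ColumnSumProcess n m State)

/-- The content of the memory of machine `j` at time `t` of the simulation on input `S`: its own
set, the incidence sets of the elements of its block (from time `1` on), the state of the process,
and (at even positive times) the `j`-th sum of the current step. -/
def memory (S : Fin m → Finset (Fin n)) (t : ℕ) (j : Fin m) :
    Finset (Fin n) × (Fin n → Finset (Fin m)) × State × ℕ :=
  (S j, fun e => if t ≠ 0 ∧ e ∈ block n j then incidence S e else ∅, Q.run S ((t - 1) / 2),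
    if t ≠ 0 ∧ t % 2 = 0 then Q.answers S (t / 2 - 1) (Q.run S (t / 2 - 1)) j else 0)

/-- A process whose states fit into `B` bits and whose sums fit into `b` bits can be simulated
with two rounds per step, after one round in which the incidence matrix is transposed. In the first
round of a step, every machine sends to machine `j` the part of the `j`-th sum that belongs to its
block; in the second round, every machine sends its sum to all. -/
theorem exists_mpcAlgorithm (hm : 1 ≤ m) (hmn : m ≤ n) (states : Finset State) (B b q M steps : ℕ)
    (hstates : ∀ S i, Q.run S i ∈ states) (hB : states.card ≤ 2 ^ B)
    (hq : ∀ i s e N j, Q.query i s e N j ≤ q) (hb : n * q < 2 ^ b)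
    (hM : 3 * n + n * b + B + b ≤ M) (out : State → Finset (Fin m)) :
    ∃ P : MPCAlgorithm n m M (1 + 2 * steps), P.RespectsBandwidth ∧
      ∀ S ω, P.result S ω = out (Q.run S steps) := by
  classical
  have : Nonempty State := ⟨Q.init⟩
  have hblock : ∀ j : Fin m, m * (block n j).card ≤ 2 * n := fun j =>
    (mul_card_block_le n j).trans (by omega)
  -- the possible memory contents of machine `j`
  let legal : Fin m → Finset (Finset (Fin n) × (Fin n → Finset (Fin m)) × State × ℕ) := fun j =>
    Finset.univ ×ˢ (Fintype.piFinset fun e => if e ∈ block n j then Finset.univ else {∅}) ×ˢ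
      states ×ˢ Finset.range (2 ^ b)
  have hlegal : ∀ j, (legal j).card ≤ 2 ^ M := by
    intro j
    have h1 : (Fintype.piFinset fun e : Fin n =>
        if e ∈ block n j then (Finset.univ : Finset (Finset (Fin m))) else {∅}).card
        = 2 ^ (m * (block n j).card) := by
      have h0 : ∀ e : Fin n, (if e ∈ block n j then (Finset.univ : Finset (Finset (Fin m)))
          else {∅}).card = if e ∈ block n j then 2 ^ m else 1 := by
        intro e; split_ifs <;> simp
      rw [Fintype.card_piFinset, Finset.prod_congr rfl fun e _ => h0 e]
      rw [Finset.prod_ite_mem, Finset.univ_inter, Finset.prod_const, pow_mul]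
    simp only [legal, Finset.card_product, h1, Finset.card_range, Finset.card_univ,
      Fintype.card_finset, Fintype.card_fin]
    calc 2 ^ n * (2 ^ (m * (block n j).card) * (states.card * 2 ^ b))
        ≤ 2 ^ n * (2 ^ (2 * n) * (2 ^ B * 2 ^ b)) := by
          have h2 : 2 ^ (m * (block n j).card) ≤ 2 ^ (2 * n) :=
            Nat.pow_le_pow_right (by norm_num) (hblock j)
          exact Nat.mul_le_mul_left _ (Nat.mul_le_mul h2 (Nat.mul_le_mul_right _ hB))
      _ = 2 ^ (n + (2 * n + (B + b))) := by simp only [pow_add]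
      _ ≤ 2 ^ M := Nat.pow_le_pow_right (by norm_num) (by nlinarith [Nat.zero_le (n * b)])
  choose enc dec hed using fun j => exists_bit_encoding (legal j) M (hlegal j)
  choose encSet decSet hlenSet hedSet using fun j : Fin m =>
    exists_list_encoding (block n j).powerset (block n j).card (by simp)
  obtain ⟨encNum, decNum, hlenNum, hedNum⟩ :=
    exists_list_encoding (Finset.range (2 ^ b)) b (by simp)
  have hpart : ∀ (A : Finset (Fin n)) i s (N : Fin n → Finset (Fin m)) j,
      ∑ e ∈ A, Q.query i s e (N e) j ∈ Finset.range (2 ^ b) := by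
    intro A i s N j
    rw [Finset.mem_range]
    refine lt_of_le_of_lt ?_ hb
    calc ∑ e ∈ A, Q.query i s e (N e) j ≤ ∑ e ∈ A, q := Finset.sum_le_sum fun e _ => hq ..
      _ = A.card * q := by simp
      _ ≤ n * q := Nat.mul_le_mul_right _ (by simpa using A.card_le_univ)
  have hmem : ∀ S t j, Q.memory S t j ∈ legal j := by
    intro S t j
    simp only [legal, memory, Finset.mem_product, Finset.mem_univ, Fintype.mem_piFinset, true_and]
    refine ⟨fun e => ?_, hstates _ _, ?_⟩
    · by_cases he : e ∈ block n j <;> simp [he]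
    · split_ifs
      · exact hpart _ _ _ _ _
      · simp
  let P : MPCAlgorithm n m M (1 + 2 * steps) :=
    { load := fun j A => enc j (A, fun _ => ∅, Q.init, 0)
      send := fun t j x _ i =>
        if t.val = 0 then encSet i ((dec j x).1 ∩ block n i)
        else if t.val % 2 = 1 then
          encNum (∑ e ∈ block n j, Q.query (t.val / 2) (dec j x).2.2.1 e ((dec j x).2.1 e) i)
        else encNum (dec j x).2.2.2
      update := fun t j x _ r =>
        if t.val = 0 then enc j ((dec j x).1,
          fun e => if e ∈ block n j then Finset.univ.filter fun i => e ∈ decSet j (r i) else ∅,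
          (dec j x).2.2.1, 0)
        else if t.val % 2 = 1 then
          enc j ((dec j x).1, (dec j x).2.1, (dec j x).2.2.1, ∑ i, decNum (r i))
        else enc j ((dec j x).1, (dec j x).2.1,
          Q.next (t.val / 2 - 1) (dec j x).2.2.1 (fun i => decNum (r i)), 0)
      central := ⟨0, hm⟩
      output := fun x => out (dec ⟨0, hm⟩ x).2.2.1 }
  have hconf : ∀ S ω t, P.config S ω t = fun j => enc j (Q.memory S t.val j) := by
    intro S ω t
    induction t using Fin.induction with
    | zero =>
      funext j
      simp [MPCAlgorithm.config, memory, P, run]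
    | succ t ih =>
      have hstep : P.config S ω t.succ = fun j => P.update t j (P.config S ω t.castSucc j) (ω t j)
          (P.inbox t (P.config S ω t.castSucc) (ω t) j) := by
        simp [MPCAlgorithm.config]
      rw [hstep, ih]
      funext j
      simp only [MPCAlgorithm.inbox, P, hed _ _ (hmem _ _ _)]
      rw [Fin.val_castSucc, Fin.val_succ]
      obtain ⟨t, ht⟩ := t
      simp only
      rcases Nat.eq_zero_or_pos t with h0 | h0
      · subst h0
        have hset : ∀ i : Fin m, decSet j (encSet j (S i ∩ block n j)) = S i ∩ block n j :=
          fun i => hedSet j _ (Finset.mem_powerset.2 Finset.inter_subset_right)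
        simp only [if_true, memory, hset]
        congr 2
        simp only [Prod.mk.injEq, zero_add]
        refine ⟨?_, by simp, by simp⟩
        funext e
        by_cases he : e ∈ block n j <;> simp [he, incidence]
      · have ht0 : t ≠ 0 := h0.ne'
        rcases Nat.mod_two_eq_zero_or_one t with h2 | h2
        · have h3 : t / 2 = t / 2 - 1 + 1 := by omega
          have h4 : (t - 1) / 2 = t / 2 - 1 := by omega
          have hnum : ∀ i, decNum (encNum (Q.memory S t i).2.2.2) = (Q.memory S t i).2.2.2 :=
            fun i => hedNum _ (by
              have := hmem S t i
              simp only [legal, Finset.mem_product] at this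
              exact this.2.2.2)
          simp only [ht0, h2, if_false, zero_ne_one, hnum]
          congr 1
          have h5 : (t + 1) % 2 ≠ 0 := by omega
          have h7 : Q.run S (t / 2) = Q.next (t / 2 - 1) (Q.run S (t / 2 - 1))
              (Q.answers S (t / 2 - 1) (Q.run S (t / 2 - 1))) := by
            conv_lhs => rw [h3]
            rfl
          simp [memory, h4, h5, h0.ne', h2, h7]
        · have h3 : (t + 1 - 1) / 2 = t / 2 := by omega
          have h4 : (t - 1) / 2 = t / 2 := by omega
          have h5 : (t + 1) % 2 = 0 := by omega
          have h6 : (t + 1) / 2 - 1 = t / 2 := by omega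
          simp only [ht0, h2, if_false, if_true, hedNum _ (hpart _ _ _ _ _)]
          congr 1
          simp only [memory, h3, h4, h5, h6]
          simp only [ne_eq, h0.ne', not_false_eq_true, true_and, and_true, Nat.add_eq_zero_iff,
            one_ne_zero, and_false, if_true, Prod.mk.injEq]
          rw [answers, ← sum_blocks hm
            (fun e => Q.query (t / 2) (Q.run S (t / 2)) e (incidence S e) j)]
          refine Finset.sum_congr rfl fun i _ => Finset.sum_congr rfl fun e he => ?_
          rw [if_pos he]
  refine ⟨P, ?_, ?_⟩
  · intro S ω t j
    have hlen : ∀ i, (P.inbox t (P.config S ω t.castSucc) (ω t) j i).length ≤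
        if t.val = 0 then (block n j).card else b := by
      intro i
      simp only [MPCAlgorithm.inbox, P]
      split_ifs <;> simp [hlenSet, hlenNum]
    refine (Finset.sum_le_sum fun i _ => hlen i).trans ?_
    rw [Finset.sum_const, Finset.card_univ, Fintype.card_fin, smul_eq_mul]
    split_ifs
    · have := hblock j
      have := Nat.zero_le (n * b)
      omega
    · have := Nat.mul_le_mul_right b hmn
      omega
  · intro S ω
    have h : (1 + 2 * steps - 1) / 2 = steps := by omega
    simp only [MPCAlgorithm.result, hconf]
    simp only [P]
    rw [hed _ _ (hmem _ _ _)]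
    simp only [memory, Fin.val_last, h]

end ColumnSumProcess

/-! ### Elementary facts about coverage -/

lemma coverage_eq_card {n m : ℕ} (S : Fin m → Finset (Fin n)) (F : Finset (Fin m)) :
    coverage S F = (Finset.univ.filter fun e => ¬ Disjoint (incidence S e) F).card := by
  rw [coverage]
  congr 1
  ext e
  simp [Finset.not_disjoint_iff, incidence, and_comm]

lemma coverage_mono {n m : ℕ} (S : Fin m → Finset (Fin n)) {F G : Finset (Fin m)} (h : F ⊆ G) :
    coverage S F ≤ coverage S G :=
  Finset.card_le_card (Finset.biUnion_subset_biUnion_of_subset_left S h)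

lemma coverage_le {n m : ℕ} (S : Fin m → Finset (Fin n)) (F : Finset (Fin m)) :
    coverage S F ≤ n := by
  simpa [coverage] using (F.biUnion S).card_le_univ

lemma exists_coverage_eq_maxCoverage {n m k : ℕ} (hk : k ≤ m) (S : Fin m → Finset (Fin n)) :
    ∃ O : Finset (Fin m), O.card = k ∧ coverage S O = maxCoverage S k := by
  obtain ⟨O, hO, h⟩ := Finset.exists_mem_eq_sup
    (Finset.powersetCard k (Finset.univ : Finset (Fin m)))
    (Finset.powersetCard_nonempty.2 (by simpa using hk)) (coverage S)
  exact ⟨O, (Finset.mem_powersetCard.1 hO).2, h.symm⟩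

/-- Any family of at most `k` indices can be padded to exactly `k` indices. -/
lemma exists_pad {m k : ℕ} (hk : k ≤ m) :
    ∃ pad : Finset (Fin m) → Finset (Fin m), ∀ F, F.card ≤ k → (pad F).card = k ∧ F ⊆ pad F := by
  have h : ∀ F : Finset (Fin m), ∃ G : Finset (Fin m), F.card ≤ k → G.card = k ∧ F ⊆ G := by
    intro F
    by_cases hF : F.card ≤ k
    · obtain ⟨G, hG, hc⟩ := Finset.exists_superset_card_eq hF (by simpa using hk)
      exact ⟨G, fun _ => ⟨hc, hG⟩⟩
    · exact ⟨∅, fun h => absurd h hF⟩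
  choose pad hpad using h
  exact ⟨pad, hpad⟩

/-- Double counting of the pairs of an index `j ∈ B` and an element incident with `j`. -/
lemma sum_sum_ite_incidence {n m : ℕ} (B : Finset (Fin m)) (N : Fin n → Finset (Fin m))
    (f : Fin n → ℕ) :
    ∑ j ∈ B, ∑ e, (if j ∈ N e then f e else 0) = ∑ e, (N e ∩ B).card * f e := by
  rw [Finset.sum_comm]
  refine Finset.sum_congr rfl fun e _ => ?_
  rw [Finset.sum_ite_mem, Finset.sum_const, smul_eq_mul, Finset.inter_comm]

/-- The best `k` of `m` numbers have at least the average `k`-th part of the total. -/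
lemma exists_card_eq_mul_sum_le {m k : ℕ} (hk : k ≤ m) (g : Fin m → ℕ) :
    ∃ B : Finset (Fin m), B.card = k ∧ k * ∑ j, g j ≤ m * ∑ j ∈ B, g j := by
  induction hk using Nat.decreasingInduction with
  | self => exact ⟨Finset.univ, by simp, le_rfl⟩
  | of_succ k hkm ih =>
    obtain ⟨B, hB, h⟩ := ih
    have hne : B.Nonempty := Finset.card_pos.1 (by omega)
    obtain ⟨j, hj, hmin⟩ := B.exists_min_image g hne
    refine ⟨B.erase j, by simp [Finset.card_erase_of_mem hj, hB], ?_⟩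
    have h1 : (k + 1) * g j ≤ ∑ i ∈ B, g i := by
      have := B.card_nsmul_le_sum g (g j) hmin
      rwa [hB, smul_eq_mul] at this
    have h2 := Finset.add_sum_erase B g hj
    have h3 : (k + 1) * (k * ∑ i, g i) ≤ (k + 1) * (m * ∑ i ∈ B.erase j, g i) := by
      have h4 : k * ∑ i ∈ B, g i ≤ (k + 1) * ∑ i ∈ B.erase j, g i := by nlinarith
      calc (k + 1) * (k * ∑ i, g i) = k * ((k + 1) * ∑ i, g i) := by ring
        _ ≤ k * (m * ∑ i ∈ B, g i) := Nat.mul_le_mul_left _ h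
        _ = m * (k * ∑ i ∈ B, g i) := by ring
        _ ≤ m * ((k + 1) * ∑ i ∈ B.erase j, g i) := Nat.mul_le_mul_left _ h4
        _ = _ := by ring
    exact Nat.le_of_mul_le_mul_left h3 (by omega)

/-- Some `k` of the `m` sets cover at least the fraction `k / m` of the elements of the union. -/
lemma mul_card_incidence_nonempty_le {n m k : ℕ} (hm : 1 ≤ m) (hk : k ≤ m)
    (S : Fin m → Finset (Fin n)) :
    k * (Finset.univ.filter fun e => (incidence S e).Nonempty).card ≤ m * maxCoverage S k := by
  classical
  set U := Finset.univ.filter fun e => (incidence S e).Nonempty with hU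
  -- every covered element is assigned to one of the sets that contain it
  let a : Fin n → Fin m := fun e => if h : (incidence S e).Nonempty then h.choose else ⟨0, hm⟩
  obtain ⟨B, hB, h⟩ := exists_card_eq_mul_sum_le hk fun j => (U.filter fun e => a e = j).card
  have h1 : ∑ j, (U.filter fun e => a e = j).card = U.card :=
    (Finset.card_eq_sum_card_fiberwise (by simp)).symm
  have h2 : ∑ j ∈ B, (U.filter fun e => a e = j).card ≤ coverage S B := by
    rw [coverage_eq_card]
    have h3 := Finset.card_eq_sum_card_fiberwise (s := U.filter fun e => a e ∈ B) (t := B) (f := a)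
      (by intro e he; simpa using (Finset.mem_filter.1 he).2)
    have h4 : ∀ j ∈ B, ((U.filter fun e => a e ∈ B).filter fun e => a e = j) =
        U.filter fun e => a e = j := by
      intro j hj
      ext e
      simp only [Finset.mem_filter]
      constructor
      · rintro ⟨⟨h1, -⟩, h2⟩
        exact ⟨h1, h2⟩
      · rintro ⟨h1, h2⟩
        exact ⟨⟨h1, h2 ▸ hj⟩, h2⟩
    rw [Finset.sum_congr rfl fun j hj => by rw [h4 j hj]] at h3
    rw [← h3]
    refine Finset.card_le_card fun e he => ?_
    simp only [hU, Finset.mem_filter, Finset.mem_univ, true_and] at he ⊢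
    rw [Finset.not_disjoint_iff]
    refine ⟨a e, ?_, he.2⟩
    simp only [a, he.1, dif_pos]
    exact he.1.choose_spec
  have h5 : coverage S B ≤ maxCoverage S k :=
    Finset.le_sup (f := coverage S) (Finset.mem_powersetCard.2 ⟨B.subset_univ, hB⟩)
  rw [h1] at h
  exact h.trans (Nat.mul_le_mul_left _ (h2.trans h5))

/-! ### The greedy algorithm -/

/-- The greedy algorithm: the state is the family of chosen sets, the `j`-th sum is the number of
uncovered elements of the `j`-th set. -/
noncomputable def greedyProcess (n m : ℕ) : ColumnSumProcess n m (Finset (Fin m)) where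
  init := ∅
  query := fun _ F _ N j => if j ∈ N then (if Disjoint N F then 1 else 0) else 0
  next := fun _ F g => if h : ∃ j, ∀ i, g i ≤ g j then insert h.choose F else F

lemma card_greedyProcess_run_le {n m : ℕ} (S : Fin m → Finset (Fin n)) (t : ℕ) :
    ((greedyProcess n m).run S t).card ≤ t := by
  induction t with
  | zero => simp [ColumnSumProcess.run, greedyProcess]
  | succ t ih =>
    simp only [ColumnSumProcess.run]
    generalize (greedyProcess n m).run S t = F at ih ⊢
    simp only [greedyProcess]
    split_ifs
    · exact (Finset.card_insert_le _ _).trans (by omega)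
    · omega

/-- In every step, greedy covers at least the `k`-th part of what the optimum covers in addition. -/
lemma greedyProcess_step {n m k : ℕ} (hm : 1 ≤ m) (S : Fin m → Finset (Fin n))
    (O : Finset (Fin m)) (hO : O.card = k) (t : ℕ) :
    k * coverage S ((greedyProcess n m).run S t) + coverage S O ≤
      k * coverage S ((greedyProcess n m).run S (t + 1)) +
        coverage S ((greedyProcess n m).run S t) := by
  classical
  simp only [ColumnSumProcess.run]
  generalize (greedyProcess n m).run S t = F
  set g := (greedyProcess n m).answers S t F with hg
  have hgj : ∀ j, g j = ∑ e, if j ∈ incidence S e then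
      (if Disjoint (incidence S e) F then 1 else 0) else 0 := fun j => by
    simp [hg, ColumnSumProcess.answers, greedyProcess]
  have hex : ∃ j, ∀ i, g i ≤ g j := by
    have : Nonempty (Fin m) := ⟨⟨0, hm⟩⟩
    obtain ⟨j, -, hj⟩ := Finset.univ.exists_max_image g Finset.univ_nonempty
    exact ⟨j, fun i => hj i (Finset.mem_univ _)⟩
  have hnext : (greedyProcess n m).next t F g = insert hex.choose F := by
    simp only [greedyProcess]
    rw [dif_pos hex]
  rw [hnext]
  have hmax := hex.choose_spec
  generalize hex.choose = j at hmax
  have hins : coverage S (insert j F) = coverage S F + g j := by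
    simp only [coverage_eq_card, Finset.card_filter, hgj, ← Finset.sum_add_distrib]
    refine Finset.sum_congr rfl fun e _ => ?_
    by_cases h1 : j ∈ incidence S e <;> by_cases h2 : Disjoint (incidence S e) F <;>
      simp [h1, h2, Finset.disjoint_insert_right]
  have hopt : coverage S O ≤ coverage S F + ∑ i ∈ O, g i := by
    simp only [hgj]
    rw [sum_sum_ite_incidence]
    simp only [coverage_eq_card, Finset.card_filter, ← Finset.sum_add_distrib]
    refine Finset.sum_le_sum fun e _ => ?_
    by_cases h1 : Disjoint (incidence S e) O
    · simp [h1]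
    · have h3 : 1 ≤ (incidence S e ∩ O).card := by
        rw [Finset.one_le_card, ← Finset.not_disjoint_iff_nonempty_inter]
        exact h1
      by_cases h2 : Disjoint (incidence S e) F
      · simpa [h1, h2] using h3
      · simp [h1, h2]
  have hsum : ∑ i ∈ O, g i ≤ k * g j := by
    have := O.sum_le_card_nsmul g (g j) fun i _ => hmax i
    rwa [hO, smul_eq_mul] at this
  rw [hins]
  nlinarith

/-- Nemhauser, Wolsey and Fisher: `k` greedy steps cover the fraction `1 - 1 / e` of the
optimum. -/
lemma maxCoverage_le_greedyProcess {n m k : ℕ} (hk0 : 1 ≤ k) (hk : k ≤ m)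
    (S : Fin m → Finset (Fin n)) :
    (1 - 1 / Real.exp 1) * (maxCoverage S k : ℝ) ≤
      (coverage S ((greedyProcess n m).run S k) : ℝ) := by
  obtain ⟨O, hO, hopt⟩ := exists_coverage_eq_maxCoverage hk S
  have hk' : (0 : ℝ) < k := by exact_mod_cast hk0
  have hb : (0 : ℝ) ≤ 1 - 1 / k := by
    rw [sub_nonneg, div_le_one hk']
    exact_mod_cast hk0
  have key : ∀ t, (maxCoverage S k : ℝ) - coverage S ((greedyProcess n m).run S t) ≤
      (1 - 1 / (k : ℝ)) ^ t * maxCoverage S k := by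
    intro t
    induction t with
    | zero => simp
    | succ t ih =>
      have h := greedyProcess_step (hk0.trans hk) S O hO t
      rw [hopt] at h
      have h' : (k : ℝ) * coverage S ((greedyProcess n m).run S t) + maxCoverage S k ≤
          k * coverage S ((greedyProcess n m).run S (t + 1)) +
            coverage S ((greedyProcess n m).run S t) := by exact_mod_cast h
      rw [pow_succ, mul_comm ((1 - 1 / (k : ℝ)) ^ t), mul_assoc]
      refine le_trans ?_ (mul_le_mul_of_nonneg_left ih hb)
      rw [sub_mul, one_mul, one_div, inv_mul_eq_div, le_sub_iff_add_le, ← le_sub_iff_add_le',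
        div_le_iff₀ hk']
      linarith
  have h1 : (1 - 1 / (k : ℝ)) ^ k ≤ 1 / Real.exp 1 := by
    have h2 : 1 - 1 / (k : ℝ) ≤ Real.exp (-(1 / k)) := by
      have := Real.add_one_le_exp (-(1 / (k : ℝ)))
      linarith
    calc (1 - 1 / (k : ℝ)) ^ k ≤ Real.exp (-(1 / k)) ^ k := pow_le_pow_left₀ hb h2 k
      _ = 1 / Real.exp 1 := by
        rw [← Real.exp_nat_mul, one_div (Real.exp 1), ← Real.exp_neg]
        congr 1
        field_simp
  have h3 := key k
  have h4 := mul_le_mul_of_nonneg_right h1 (Nat.cast_nonneg (α := ℝ) (maxCoverage S k))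
  linarith

/-! ### A small family of samples that is good for all incidence sets -/

/-- If `k` indices are drawn independently from the distribution `p`, then all of them avoid `N`
with probability `(1 - p N) ^ k`. -/
lemma sum_prod_mul_avoid {m : ℕ} (p : Fin m → ℝ) (hp1 : ∑ j, p j = 1) (k : ℕ)
    (N : Finset (Fin m)) :
    ∑ u : Fin k → Fin m, (∏ l, p (u l)) * (if ∀ l, u l ∉ N then 1 else 0) =
      (1 - ∑ j ∈ N, p j) ^ k := by
  classical
  have h1 : 1 - ∑ j ∈ N, p j = ∑ j ∈ Nᶜ, p j := by
    rw [← hp1, ← Finset.sum_add_sum_compl N p]; ring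
  have h2 := Finset.prod_univ_sum (fun _ : Fin k => Nᶜ) (fun _ j => p j)
  rw [Finset.prod_const, Finset.card_univ, Fintype.card_fin] at h2
  rw [h1, h2]
  simp only [mul_ite, mul_one, mul_zero]
  rw [← Finset.sum_filter]
  refine Finset.sum_congr ?_ fun _ _ => rfl
  ext u
  simp [Fintype.mem_piFinset]

lemma sum_prod_eq_one {m : ℕ} (p : Fin m → ℝ) (hp1 : ∑ j, p j = 1) (k : ℕ) :
    ∑ u : Fin k → Fin m, ∏ l, p (u l) = 1 := by
  simpa using sum_prod_mul_avoid p hp1 k ∅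

/-- A derandomized Chernoff and union bound: samples are added one by one so that the exponential
potential, summed over all sets `N` of indices, grows by a factor of at most `1 + lam ^ 2`. -/
lemma exists_samples_potential_le {m : ℕ} (p : Fin m → ℝ) (hp0 : ∀ j, 0 ≤ p j)
    (hp1 : ∑ j, p j = 1) (k : ℕ) (lam : ℝ) (h0 : 0 ≤ lam) (h1 : lam ≤ 1) (L : ℕ) :
    ∃ v : ℕ → Fin k → Fin m,
      ∑ N : Finset (Fin m), Real.exp (∑ i ∈ Finset.range L,
        lam * ((if ∀ l, v i l ∉ N then 1 else 0) - (1 - ∑ j ∈ N, p j) ^ k)) ≤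
      2 ^ m * (1 + lam ^ 2) ^ L := by
  have hpr : ∀ u : Fin k → Fin m, 0 ≤ ∏ l, p (u l) := fun u => Finset.prod_nonneg fun _ _ => hp0 _
  have hbase : ∀ N : Finset (Fin m), 0 ≤ 1 - ∑ j ∈ N, p j := by
    intro N
    rw [sub_nonneg, ← hp1]
    exact Finset.sum_le_sum_of_subset_of_nonneg N.subset_univ fun _ _ _ => hp0 _
  have hq0 : ∀ N : Finset (Fin m), 0 ≤ (1 - ∑ j ∈ N, p j) ^ k := fun N => pow_nonneg (hbase N) k
  have hq1 : ∀ N : Finset (Fin m), (1 - ∑ j ∈ N, p j) ^ k ≤ 1 := fun N =>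
    pow_le_one₀ (hbase N) (by linarith [Finset.sum_nonneg fun j (_ : j ∈ N) => hp0 j])
  have hone := sum_prod_eq_one p hp1 k
  induction L with
  | zero =>
    obtain ⟨u, -, -⟩ : ∃ u ∈ (Finset.univ : Finset (Fin k → Fin m)), ∏ l, p (u l) ≠ 0 :=
      Finset.exists_ne_zero_of_sum_ne_zero (by rw [hone]; exact one_ne_zero)
    exact ⟨fun _ => u, by simp⟩
  | succ L ih =>
    obtain ⟨v, hv⟩ := ih
    set Φ : Finset (Fin m) → ℝ := fun N => Real.exp (∑ i ∈ Finset.range L,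
        lam * ((if ∀ l, v i l ∉ N then 1 else 0) - (1 - ∑ j ∈ N, p j) ^ k)) with hΦ
    have hexp : ∀ N : Finset (Fin m), ∑ u : Fin k → Fin m, (∏ l, p (u l)) *
        Real.exp (lam * ((if ∀ l, u l ∉ N then 1 else 0) - (1 - ∑ j ∈ N, p j) ^ k)) ≤
        1 + lam ^ 2 := by
      intro N
      have h2 : ∀ u : Fin k → Fin m, (∏ l, p (u l)) *
          Real.exp (lam * ((if ∀ l, u l ∉ N then 1 else 0) - (1 - ∑ j ∈ N, p j) ^ k)) ≤
          (1 + lam ^ 2 - lam * (1 - ∑ j ∈ N, p j) ^ k) * (∏ l, p (u l)) +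
            lam * ((∏ l, p (u l)) * (if ∀ l, u l ∉ N then 1 else 0)) := by
        intro u
        set y : ℝ := (if ∀ l, u l ∉ N then 1 else 0) - (1 - ∑ j ∈ N, p j) ^ k with hy
        have hy1 : |y| ≤ 1 := by
          rw [abs_le]
          have := hq0 N
          have := hq1 N
          split_ifs at hy <;> constructor <;> linarith
        have hly : |lam * y| ≤ lam := by
          rw [abs_mul, abs_of_nonneg h0]
          exact mul_le_of_le_one_right h0 hy1
        have h3 := (abs_le.1 (Real.abs_exp_sub_one_sub_id_le (hly.trans h1))).2
        have h4 : (lam * y) ^ 2 ≤ lam ^ 2 := by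
          rw [← sq_abs]
          exact pow_le_pow_left₀ (abs_nonneg _) hly 2
        have h5 : Real.exp (lam * y) ≤ 1 + lam * y + lam ^ 2 := by linarith
        calc (∏ l, p (u l)) * Real.exp (lam * y)
            ≤ (∏ l, p (u l)) * (1 + lam * y + lam ^ 2) := mul_le_mul_of_nonneg_left h5 (hpr u)
          _ = _ := by rw [hy]; ring
      refine (Finset.sum_le_sum fun u _ => h2 u).trans ?_
      rw [Finset.sum_add_distrib, ← Finset.mul_sum, ← Finset.mul_sum, hone,
        sum_prod_mul_avoid p hp1 k N]
      linarith
    have hsum : ∑ u : Fin k → Fin m, (∏ l, p (u l)) * ∑ N, Φ N *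
        Real.exp (lam * ((if ∀ l, u l ∉ N then 1 else 0) - (1 - ∑ j ∈ N, p j) ^ k)) ≤
        ∑ u : Fin k → Fin m, (∏ l, p (u l)) * (2 ^ m * (1 + lam ^ 2) ^ (L + 1)) := by
      rw [← Finset.sum_mul, hone, one_mul]
      simp only [Finset.mul_sum]
      rw [Finset.sum_comm]
      calc ∑ N, ∑ u : Fin k → Fin m, (∏ l, p (u l)) * (Φ N *
            Real.exp (lam * ((if ∀ l, u l ∉ N then 1 else 0) - (1 - ∑ j ∈ N, p j) ^ k)))
          = ∑ N, Φ N * ∑ u : Fin k → Fin m, (∏ l, p (u l)) *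
            Real.exp (lam * ((if ∀ l, u l ∉ N then 1 else 0) - (1 - ∑ j ∈ N, p j) ^ k)) := by
            refine Finset.sum_congr rfl fun N _ => ?_
            rw [Finset.mul_sum]
            exact Finset.sum_congr rfl fun u _ => by ring
        _ ≤ ∑ N, Φ N * (1 + lam ^ 2) := Finset.sum_le_sum fun N _ =>
            mul_le_mul_of_nonneg_left (hexp N) (Real.exp_pos _).le
        _ = (∑ N, Φ N) * (1 + lam ^ 2) := by rw [Finset.sum_mul]
        _ ≤ 2 ^ m * (1 + lam ^ 2) ^ L * (1 + lam ^ 2) :=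
            mul_le_mul_of_nonneg_right hv (by positivity)
        _ = _ := by ring
    have hex : ∃ u : Fin k → Fin m, ∑ N, Φ N *
        Real.exp (lam * ((if ∀ l, u l ∉ N then 1 else 0) - (1 - ∑ j ∈ N, p j) ^ k)) ≤
        2 ^ m * (1 + lam ^ 2) ^ (L + 1) := by
      by_contra hcon
      push Not at hcon
      obtain ⟨u, -, hu⟩ : ∃ u ∈ (Finset.univ : Finset (Fin k → Fin m)), ∏ l, p (u l) ≠ 0 :=
        Finset.exists_ne_zero_of_sum_ne_zero (by rw [hone]; exact one_ne_zero)
      refine absurd hsum (not_le.2 (Finset.sum_lt_sum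
        (fun u _ => mul_le_mul_of_nonneg_left (hcon u).le (hpr u)) ⟨u, Finset.mem_univ _, ?_⟩))
      exact mul_lt_mul_of_pos_left (hcon u) (lt_of_le_of_ne (hpr u) hu.symm)
    obtain ⟨u, hu⟩ := hex
    refine ⟨fun i => if i = L then u else v i, le_trans (le_of_eq ?_) hu⟩
    refine Finset.sum_congr rfl fun N _ => ?_
    rw [Finset.sum_range_succ, Real.exp_add, hΦ]
    simp only [if_true]
    congr 2
    refine Finset.sum_congr rfl fun i hi => ?_
    simp only [if_neg (Finset.mem_range.1 hi).ne]

/-- There are `4 * q ^ 2 * m` samples of `k` indices such that every `N` is avoided by a fraction of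
the samples that exceeds the probability to avoid `N` by at most `1 / q`. -/
lemma exists_samples {m : ℕ} (p : Fin m → ℝ) (hp0 : ∀ j, 0 ≤ p j) (hp1 : ∑ j, p j = 1) (k q : ℕ)
    (hq : 1 ≤ q) :
    ∃ v : ℕ → Fin k → Fin m, ∀ N : Finset (Fin m),
      ∑ i ∈ Finset.range (4 * q ^ 2 * m), (if ∀ l, v i l ∉ N then (1 : ℝ) else 0) ≤
        ((1 - ∑ j ∈ N, p j) ^ k + 1 / q) * (4 * q ^ 2 * m) := by
  have hq0 : (0 : ℝ) < q := by exact_mod_cast hq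
  have hq1 : (1 : ℝ) ≤ q := by exact_mod_cast hq
  have hlam1 : 1 / (2 * (q : ℝ)) ≤ 1 := by
    rw [div_le_one (by positivity)]
    linarith
  obtain ⟨v, hv⟩ := exists_samples_potential_le p hp0 hp1 k (1 / (2 * q)) (by positivity) hlam1
    (4 * q ^ 2 * m)
  refine ⟨v, fun N => ?_⟩
  set Z : ℝ := ∑ i ∈ Finset.range (4 * q ^ 2 * m), (if ∀ l, v i l ∉ N then (1 : ℝ) else 0) with hZ
  have h1 : Real.exp (1 / (2 * q) * (Z - (4 * q ^ 2 * m) * (1 - ∑ j ∈ N, p j) ^ k)) ≤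
      2 ^ m * (1 + (1 / (2 * (q : ℝ))) ^ 2) ^ (4 * q ^ 2 * m) := by
    refine le_trans (le_of_eq ?_) ((Finset.single_le_sum
      (f := fun N : Finset (Fin m) => Real.exp (∑ i ∈ Finset.range (4 * q ^ 2 * m),
        1 / (2 * (q : ℝ)) * ((if ∀ l, v i l ∉ N then 1 else 0) - (1 - ∑ j ∈ N, p j) ^ k)))
      (fun _ _ => (Real.exp_pos _).le) (Finset.mem_univ N)).trans hv)
    rw [← Finset.mul_sum, Finset.sum_sub_distrib, ← hZ, Finset.sum_const, Finset.card_range,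
      nsmul_eq_mul]
    push_cast
    rfl
  have h2 : (2 : ℝ) ^ m * (1 + (1 / (2 * (q : ℝ))) ^ 2) ^ (4 * q ^ 2 * m) ≤
      Real.exp (m + m) := by
    rw [Real.exp_add]
    refine mul_le_mul ?_ ?_ (by positivity) (Real.exp_pos _).le
    · calc (2 : ℝ) ^ m ≤ Real.exp 1 ^ m :=
            pow_le_pow_left₀ (by norm_num) (by linarith [Real.add_one_le_exp (1 : ℝ)]) m
        _ = Real.exp m := by rw [← Real.exp_nat_mul, mul_one]
    · calc (1 + (1 / (2 * (q : ℝ))) ^ 2) ^ (4 * q ^ 2 * m)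
          ≤ Real.exp ((1 / (2 * (q : ℝ))) ^ 2) ^ (4 * q ^ 2 * m) :=
            pow_le_pow_left₀ (by positivity)
              (by linarith [Real.add_one_le_exp ((1 / (2 * (q : ℝ))) ^ 2)]) _
        _ = Real.exp m := by
          rw [← Real.exp_nat_mul]
          congr 1
          push_cast
          field_simp
          ring
  have h3 := Real.exp_le_exp.1 (h1.trans h2)
  rw [one_div, inv_mul_eq_div, div_le_iff₀ (by positivity)] at h3
  have h4 : ((1 - ∑ j ∈ N, p j) ^ k + 1 / q) * (4 * q ^ 2 * m) =
      (4 * q ^ 2 * m) * (1 - ∑ j ∈ N, p j) ^ k + (m + m) * (2 * q) := by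
    field_simp
    ring
  rw [h4]
  linarith

/-! ### Rounding a fractional solution -/

lemma sum_range_mul {M : Type*} [AddCommMonoid M] (a m : ℕ) (f : ℕ → M) :
    ∑ i ∈ Finset.range (a * m), f i = ∑ b ∈ Finset.range a, ∑ j : Fin m, f (b * m + j) := by
  induction a with
  | zero => simp
  | succ a ih =>
    rw [Nat.succ_mul, Finset.sum_range_add, ih, Finset.sum_range_succ,
      Fin.sum_univ_eq_sum_range (fun j => f (a * m + j))]

/-- `cand` is a list of `4 * q ^ 2` batches of `m` families of at most `k` indices that rounds the
fractional solution `x / R`: on average over the list, a set `N` of indices is avoided with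
probability at most `1 / q` more than if `k` indices were drawn independently from a mixture of
`x / (k * R)`, with weight `1 - 1 / q`, and the uniform distribution, with weight `1 / q`. -/
def IsRounding {m : ℕ} (k q R : ℕ) (x : Fin m → ℕ) (cand : ℕ → Fin m → Finset (Fin m)) : Prop :=
  (∀ b j, (cand b j).card ≤ k) ∧ ∀ N : Finset (Fin m),
    ∑ b ∈ Finset.range (4 * q ^ 2), ∑ j, (if Disjoint N (cand b j) then (1 : ℝ) else 0) ≤
      (Real.exp (-((1 - 1 / q) * ((∑ l ∈ N, x l : ℕ) / R) + N.card * k / (q * m))) + 1 / q) *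
        (4 * q ^ 2 * m)

lemma exists_isRounding {m k q R : ℕ} (hm : 1 ≤ m) (hk : 1 ≤ k) (hq : 1 ≤ q) (hR : 1 ≤ R)
    (x : Fin m → ℕ) (hx : ∑ j, x j = k * R) : ∃ cand, IsRounding k q R x cand := by
  have hm0 : (0 : ℝ) < m := by exact_mod_cast hm
  have hk0 : (0 : ℝ) < k := by exact_mod_cast hk
  have hq0 : (0 : ℝ) < q := by exact_mod_cast hq
  have hR0 : (0 : ℝ) < R := by exact_mod_cast hR
  have hq1 : (0 : ℝ) ≤ 1 - 1 / q := by
    rw [sub_nonneg, div_le_one hq0]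
    exact_mod_cast hq
  let p : Fin m → ℝ := fun j => (1 - 1 / q) * (x j / (k * R)) + 1 / (q * m)
  have hp0 : ∀ j, 0 ≤ p j := fun j => by positivity
  have hpN : ∀ N : Finset (Fin m), ∑ j ∈ N, p j =
      (1 - 1 / q) * ((∑ l ∈ N, x l : ℕ) / (k * R)) + N.card * (1 / (q * m)) := by
    intro N
    simp only [p, Finset.sum_add_distrib, ← Finset.mul_sum, ← Finset.sum_div, Finset.sum_const,
      nsmul_eq_mul, Nat.cast_sum, mul_div_assoc]
  have hp1 : ∑ j, p j = 1 := by
    rw [hpN, hx, Finset.card_univ, Fintype.card_fin]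
    push_cast
    field_simp
    ring
  obtain ⟨v, hv⟩ := exists_samples p hp0 hp1 k q hq
  refine ⟨fun b j => Finset.univ.image (v (b * m + j)), fun b j => ?_, fun N => ?_⟩
  · exact Finset.card_image_le.trans (by simp)
  · have h1 := hv N
    rw [sum_range_mul] at h1
    have h2 : ∀ u : Fin k → Fin m, Disjoint N (Finset.univ.image u) ↔ ∀ l, u l ∉ N := by
      intro u
      rw [disjoint_comm, Finset.disjoint_left]
      simp
    simp only [h2]
    refine h1.trans (mul_le_mul_of_nonneg_right (add_le_add_left ?_ _) (by positivity))
    have h3 : 0 ≤ 1 - ∑ j ∈ N, p j := by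
      rw [sub_nonneg, ← hp1]
      exact Finset.sum_le_sum_of_subset_of_nonneg N.subset_univ fun _ _ _ => hp0 _
    calc (1 - ∑ j ∈ N, p j) ^ k ≤ Real.exp (-∑ j ∈ N, p j) ^ k :=
          pow_le_pow_left₀ h3 (by linarith [Real.add_one_le_exp (-∑ j ∈ N, p j)]) k
      _ = Real.exp (-((1 - 1 / q) * ((∑ l ∈ N, x l : ℕ) / R) + N.card * k / (q * m))) := by
        rw [← Real.exp_nat_mul, hpN]
        congr 1
        field_simp

/-! ### The continuous greedy algorithm -/

/-- The weight `q * exp (- x N / R)`, rounded down, of an element with incidence set `N`. Elements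
contained in more than `D` sets have weight zero: they are left to random sampling. -/
noncomputable def roundedWeight {m : ℕ} (q D R : ℕ) (x : Fin m → ℕ) (N : Finset (Fin m)) : ℕ :=
  if N.card ≤ D then ⌊(q : ℝ) * Real.exp (-((∑ l ∈ N, x l : ℕ) / R))⌋₊ else 0

lemma roundedWeight_le {m : ℕ} (q D R : ℕ) (x : Fin m → ℕ) (N : Finset (Fin m)) :
    roundedWeight q D R x N ≤ q := by
  rw [roundedWeight]
  split_ifs
  · refine Nat.floor_le_of_le ?_
    refine mul_le_of_le_one_right (Nat.cast_nonneg _) (Real.exp_le_one_iff.2 ?_)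
    rw [neg_nonpos]
    positivity
  · exact Nat.zero_le _

/-- Continuous greedy with `R = q * D` steps of size `1 / R`. In each step the family `B t` is at
least as good as the family `O` for the current rounded weights. As every element of positive weight
lies in at most `D` sets, its fractional coverage grows by at most `D / R = 1 / q` per step, so
that the first-order analysis loses only a factor `1 - 1 / q`. -/
lemma continuous_greedy {n m q D R : ℕ} (hq : 1 ≤ q) (hD : 1 ≤ D) (hR : R = q * D)
    (N : Fin n → Finset (Fin m)) (x : ℕ → Fin m → ℕ) (hx0 : ∀ j, x 0 j = 0)
    (B : ℕ → Finset (Fin m))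
    (hstep : ∀ t < R, ∀ j, x (t + 1) j = x t j + if j ∈ B t then 1 else 0) (O : Finset (Fin m))
    (hbest : ∀ t < R, ∑ e, (N e ∩ O).card * roundedWeight q D R (x t) (N e) ≤
      ∑ e, (N e ∩ B t).card * roundedWeight q D R (x t) (N e)) :
    (1 - 1 / Real.exp 1 - 2 / q) *
        ((Finset.univ.filter fun e => (N e).card ≤ D ∧ ¬ Disjoint (N e) O).card : ℝ) ≤
      ∑ e ∈ Finset.univ.filter fun e => (N e).card ≤ D,
        (1 - Real.exp (-((∑ l ∈ N e, x R l : ℕ) / R))) := by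
  have hq0 : (0 : ℝ) < q := by exact_mod_cast hq
  have hq1 : (1 : ℝ) ≤ q := by exact_mod_cast hq
  have hD0 : (0 : ℝ) < D := by exact_mod_cast hD
  have hR1 : 1 ≤ R := hR ▸ Nat.mul_pos hq hD
  have hR0 : (0 : ℝ) < R := by exact_mod_cast hR1
  have hRq : (R : ℝ) = q * D := by exact_mod_cast hR
  have hinv : 1 / (q : ℝ) ≤ 1 := (div_le_one hq0).2 hq1
  have hinv0 : 0 ≤ 1 / (q : ℝ) := by positivity
  set low := Finset.univ.filter fun e => (N e).card ≤ D with hlow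
  set cov := Finset.univ.filter fun e => (N e).card ≤ D ∧ ¬ Disjoint (N e) O with hcov
  have hcl : cov ⊆ low := by
    intro e
    simp only [hcov, hlow, Finset.mem_filter]
    tauto
  set E : ℕ → Fin n → ℝ := fun t e => Real.exp (-((∑ l ∈ N e, x t l : ℕ) / R)) with hE
  have hE0 : ∀ t e, 0 < E t e := fun t e => Real.exp_pos _
  have hE1 : ∀ t e, E t e ≤ 1 := fun t e =>
    Real.exp_le_one_iff.2 (neg_nonpos.2 (by positivity))
  -- the residual decreases in proportion to the weight collected by `B t`
  have hdec : ∀ t < R, ∀ e ∈ low, E (t + 1) e ≤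
      E t e - (1 - 1 / q) / R * ((N e ∩ B t).card * E t e) := by
    intro t ht e he
    have h1 : ∑ l ∈ N e, x (t + 1) l = ∑ l ∈ N e, x t l + (N e ∩ B t).card := by
      rw [Finset.sum_congr rfl fun l _ => hstep t ht l, Finset.sum_add_distrib, Finset.sum_ite_mem,
        Finset.sum_const, smul_eq_mul, mul_one]
    set y : ℝ := (N e ∩ B t).card / R with hy
    have hy0 : 0 ≤ y := by positivity
    have hy1 : y ≤ 1 / q := by
      have h2 : (N e ∩ B t).card ≤ D :=
        (Finset.card_le_card Finset.inter_subset_left).trans (Finset.mem_filter.1 he).2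
      have h3 : ((N e ∩ B t).card : ℝ) ≤ D := by exact_mod_cast h2
      rw [hy, hRq, div_le_div_iff₀ (by positivity) hq0]
      nlinarith
    have h4 : E (t + 1) e = E t e * Real.exp (-y) := by
      simp only [hE]
      rw [← Real.exp_add, h1, hy]
      push_cast
      congr 1
      ring
    have h5 : Real.exp (-y) ≤ 1 - (1 - 1 / q) * y := by
      have h6 : |-y| ≤ 1 := by
        rw [abs_neg, abs_of_nonneg hy0]
        exact hy1.trans hinv
      have h7 := (abs_le.1 (Real.abs_exp_sub_one_sub_id_le h6)).2
      nlinarith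
    calc E (t + 1) e ≤ E t e * (1 - (1 - 1 / q) * y) := by
          rw [h4]
          exact mul_le_mul_of_nonneg_left h5 (hE0 t e).le
      _ = _ := by
          rw [hy]
          ring
  have hgain : ∀ t < R, ∑ e ∈ cov, E t e - cov.card / q ≤
      ∑ e ∈ low, (N e ∩ B t).card * E t e := by
    intro t ht
    have h1 : ∑ e ∈ cov, ((q : ℝ) * E t e - 1) ≤
        ∑ e, (((N e ∩ O).card * roundedWeight q D R (x t) (N e) : ℕ) : ℝ) := by
      refine (Finset.sum_le_sum fun e he => ?_).trans (Finset.sum_le_sum_of_subset_of_nonneg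
        cov.subset_univ fun _ _ _ => Nat.cast_nonneg _)
      obtain ⟨-, h2, h3⟩ := Finset.mem_filter.1 he
      have h4 : 1 ≤ (N e ∩ O).card := by
        rw [Finset.one_le_card, ← Finset.not_disjoint_iff_nonempty_inter]
        exact h3
      have h5 : (q : ℝ) * E t e - 1 ≤ (roundedWeight q D R (x t) (N e) : ℕ) := by
        rw [roundedWeight, if_pos h2]
        exact (Nat.sub_one_lt_floor _).le
      exact h5.trans (by exact_mod_cast Nat.le_mul_of_pos_left _ h4)
    have h2 : ∑ e, (((N e ∩ B t).card * roundedWeight q D R (x t) (N e) : ℕ) : ℝ) ≤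
        ∑ e ∈ low, (N e ∩ B t).card * (q * E t e) := by
      rw [hlow, Finset.sum_filter]
      refine Finset.sum_le_sum fun e _ => ?_
      rw [roundedWeight]
      split_ifs
      · rw [Nat.cast_mul]
        exact mul_le_mul_of_nonneg_left (Nat.floor_le (mul_pos hq0 (hE0 t e)).le)
          (Nat.cast_nonneg _)
      · simp
    have h3 : ∑ e, (((N e ∩ O).card * roundedWeight q D R (x t) (N e) : ℕ) : ℝ) ≤
        ∑ e, (((N e ∩ B t).card * roundedWeight q D R (x t) (N e) : ℕ) : ℝ) := by
      exact_mod_cast hbest t ht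
    have h4 := h1.trans (h3.trans h2)
    have h5 : ∑ e ∈ low, ((N e ∩ B t).card : ℝ) * (q * E t e) =
        q * ∑ e ∈ low, (N e ∩ B t).card * E t e := by
      rw [Finset.mul_sum]
      exact Finset.sum_congr rfl fun e _ => by ring
    rw [h5, Finset.sum_sub_distrib, ← Finset.mul_sum, Finset.sum_const, nsmul_eq_mul, mul_one] at h4
    have h6 : (q : ℝ) * (∑ e ∈ cov, E t e - cov.card / q) =
        q * ∑ e ∈ cov, E t e - cov.card := by
      field_simp
    exact le_of_mul_le_mul_left (h6.trans_le h4) hq0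
  set a : ℝ := (1 - 1 / q) / R with ha
  have ha0 : 0 ≤ a := div_nonneg (by linarith) hR0.le
  have ha1 : a ≤ 1 := by
    rw [ha, div_le_one hR0]
    have : (1 : ℝ) ≤ R := by exact_mod_cast hR1
    linarith
  set h : ℕ → ℝ := fun t => ∑ e ∈ low, E t e - (low.card - cov.card) - cov.card / q with hh
  have hrec : ∀ t < R, h (t + 1) ≤ (1 - a) * h t := by
    intro t ht
    have h1 : ∑ e ∈ low, E (t + 1) e ≤
        ∑ e ∈ low, E t e - a * ∑ e ∈ low, (N e ∩ B t).card * E t e := by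
      rw [Finset.mul_sum, ← Finset.sum_sub_distrib]
      exact Finset.sum_le_sum fun e he => hdec t ht e he
    have h2 : ∑ e ∈ low, E t e - (low.card - cov.card) ≤ ∑ e ∈ cov, E t e := by
      rw [← Finset.sum_sdiff hcl]
      have h3 : ∑ e ∈ low \ cov, E t e ≤ ∑ e ∈ low \ cov, 1 := Finset.sum_le_sum fun e _ => hE1 t e
      rw [Finset.sum_const, nsmul_eq_mul, mul_one, Finset.card_sdiff_of_subset hcl,
        Nat.cast_sub (Finset.card_le_card hcl)] at h3
      linarith
    have h3 : h t ≤ ∑ e ∈ low, (N e ∩ B t).card * E t e := by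
      simp only [hh]
      linarith [hgain t ht]
    have h4 := mul_le_mul_of_nonneg_left h3 ha0
    simp only [hh] at h4 ⊢
    linarith
  have hpow : ∀ t ≤ R, h t ≤ (1 - a) ^ t * cov.card := by
    intro t
    induction t with
    | zero =>
      intro _
      have h1 : ∑ e ∈ low, E 0 e = low.card := by
        simp [hE, hx0]
      have h2 : (0 : ℝ) ≤ cov.card / q := by positivity
      simp only [hh, h1, pow_zero, one_mul]
      linarith
    | succ t ih =>
      intro ht
      refine (hrec t ht).trans ?_
      rw [pow_succ', mul_assoc]
      exact mul_le_mul_of_nonneg_left (ih (by omega)) (by linarith)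
  have hfinal : (1 - a) ^ R ≤ 1 / Real.exp 1 + 1 / q := by
    have h1 : (1 - a) ^ R ≤ Real.exp (-1) * Real.exp (1 / q) := by
      calc (1 - a) ^ R ≤ Real.exp (-a) ^ R :=
            pow_le_pow_left₀ (by linarith) (by linarith [Real.add_one_le_exp (-a)]) R
        _ = Real.exp (-1) * Real.exp (1 / q) := by
          rw [← Real.exp_nat_mul, ← Real.exp_add, ha]
          congr 1
          field_simp
          ring
    have h2 : Real.exp (1 / q) ≤ 1 + 2 * (1 / q) := by
      have h3 : |1 / (q : ℝ)| ≤ 1 := by rwa [abs_of_nonneg hinv0]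
      have h4 := (abs_le.1 (Real.abs_exp_sub_one_sub_id_le h3)).2
      nlinarith
    have h3 : Real.exp (-1) ≤ 1 / 2 := by
      rw [Real.exp_neg, ← one_div]
      exact one_div_le_one_div_of_le (by norm_num) (by linarith [Real.add_one_le_exp (1 : ℝ)])
    have h4 := Real.exp_pos (-1)
    rw [Real.exp_neg, ← one_div] at h1 h3 h4
    have h5 : 1 / Real.exp 1 * Real.exp (1 / q) ≤ 1 / Real.exp 1 * (1 + 2 * (1 / q)) :=
      mul_le_mul_of_nonneg_left h2 h4.le
    nlinarith
  have hlast := hpow R le_rfl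
  have hc0 : (0 : ℝ) ≤ cov.card := Nat.cast_nonneg _
  have h1 := mul_le_mul_of_nonneg_right hfinal hc0
  rw [Finset.sum_sub_distrib, Finset.sum_const, nsmul_eq_mul, mul_one]
  simp only [hh] at hlast
  have h2 : (1 - 1 / Real.exp 1 - 2 / q) * (cov.card : ℝ) =
      cov.card - (1 / Real.exp 1 + 1 / q) * cov.card - cov.card / q := by ring
  rw [h2]
  linarith

/-! ### Continuous greedy and rounding as a column-sum process -/

/-- A `k`-element set of indices with the largest total value of `g`. -/
noncomputable def bestSet {m : ℕ} (k : ℕ) (g : Fin m → ℕ) : Finset (Fin m) :=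
  if h : ∃ B : Finset (Fin m), B.card = k ∧ ∀ O : Finset (Fin m), O.card = k →
    ∑ j ∈ O, g j ≤ ∑ j ∈ B, g j then h.choose else ∅

lemma bestSet_spec {m k : ℕ} (hk : k ≤ m) (g : Fin m → ℕ) :
    (bestSet k g).card = k ∧ ∀ O : Finset (Fin m), O.card = k →
      ∑ j ∈ O, g j ≤ ∑ j ∈ bestSet k g, g j := by
  have h : ∃ B : Finset (Fin m), B.card = k ∧ ∀ O : Finset (Fin m), O.card = k →
      ∑ j ∈ O, g j ≤ ∑ j ∈ B, g j := by
    obtain ⟨B, hB, hmax⟩ := Finset.exists_max_image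
      (Finset.powersetCard k (Finset.univ : Finset (Fin m))) (fun B => ∑ j ∈ B, g j)
      (Finset.powersetCard_nonempty.2 (by simpa using hk))
    exact ⟨B, (Finset.mem_powersetCard.1 hB).2, fun O hO =>
      hmax O (Finset.mem_powersetCard.2 ⟨O.subset_univ, hO⟩)⟩
  rw [bestSet, dif_pos h]
  exact h.choose_spec

open Classical in
/-- A fixed choice of a rounding of `x / R`, as a function of `x`. All machines know it, so that the
`m` families of a batch can be evaluated at once although they are never communicated. -/
noncomputable def candidates {m : ℕ} (k q R : ℕ) (x : Fin m → ℕ) : ℕ → Fin m → Finset (Fin m) :=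
  if h : ∃ cand, IsRounding k q R x cand then h.choose else fun _ _ => ∅

lemma isRounding_candidates {m k q R : ℕ} {x : Fin m → ℕ} (h : ∃ cand, IsRounding k q R x cand) :
    IsRounding k q R x (candidates k q R x) := by
  rw [candidates, dif_pos h]
  exact h.choose_spec

lemma card_candidates_le {m : ℕ} (k q R : ℕ) (x : Fin m → ℕ) (b : ℕ) (j : Fin m) :
    (candidates k q R x b j).card ≤ k := by
  by_cases h : ∃ cand, IsRounding k q R x cand
  · exact (isRounding_candidates h).1 b j
  · simp [candidates, h]

/-- The state consists of the fractional solution, scaled by `R`, the best family found so far, and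
its coverage. The first `R` steps are continuous greedy steps. Step `R + b` evaluates the batch `b`
of the rounding. -/
noncomputable def coverProcess (n m k q D R : ℕ) :
    ColumnSumProcess n m ((Fin m → ℕ) × Finset (Fin m) × ℕ) where
  init := (fun _ => 0, ∅, 0)
  query := fun i s _ N j =>
    if i < R then (if j ∈ N then roundedWeight q D R s.1 N else 0)
    else if Disjoint N (candidates k q R s.1 (i - R) j) then 0 else 1
  next := fun i s g =>
    if i < R then (fun j => s.1 j + if j ∈ bestSet k g then 1 else 0, s.2)
    else if h : ∃ j, s.2.2 < g j ∧ ∀ i, g i ≤ g j then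
      (s.1, candidates k q R s.1 (i - R) h.choose, g h.choose)
    else s

namespace coverProcess

variable {n m k q D R : ℕ} (S : Fin m → Finset (Fin n))

lemma query_le (hq : 1 ≤ q) (i : ℕ) (s : (Fin m → ℕ) × Finset (Fin m) × ℕ) (e : Fin n)
    (N : Finset (Fin m)) (j : Fin m) : (coverProcess n m k q D R).query i s e N j ≤ q := by
  simp only [coverProcess]
  have := roundedWeight_le q D R s.1 N
  split_ifs <;> omega

lemma answers_of_lt {i : ℕ} (hi : i < R) (s : (Fin m → ℕ) × Finset (Fin m) × ℕ) (j : Fin m) :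
    (coverProcess n m k q D R).answers S i s j =
      ∑ e, if j ∈ incidence S e then roundedWeight q D R s.1 (incidence S e) else 0 := by
  simp [ColumnSumProcess.answers, coverProcess, hi]

lemma answers_add (b : ℕ) (s : (Fin m → ℕ) × Finset (Fin m) × ℕ) (j : Fin m) :
    (coverProcess n m k q D R).answers S (R + b) s j =
      coverage S (candidates k q R s.1 b j) := by
  simp [ColumnSumProcess.answers, coverProcess, coverage_eq_card, Finset.card_filter, ite_not]

lemma run_succ_of_lt {i : ℕ} (hi : i < R) :
    (coverProcess n m k q D R).run S (i + 1) =
      (fun j => ((coverProcess n m k q D R).run S i).1 j +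
        if j ∈ bestSet k ((coverProcess n m k q D R).answers S i
          ((coverProcess n m k q D R).run S i)) then 1 else 0,
        ((coverProcess n m k q D R).run S i).2) := by
  rw [ColumnSumProcess.run]
  exact if_pos hi

lemma run_snd_of_le {i : ℕ} (hi : i ≤ R) : ((coverProcess n m k q D R).run S i).2 = (∅, 0) := by
  induction i with
  | zero => rfl
  | succ i ih => rw [run_succ_of_lt S hi, ih (by omega)]

lemma run_fst_le {i : ℕ} (hi : i ≤ R) (j : Fin m) :
    ((coverProcess n m k q D R).run S i).1 j ≤ i := by
  induction i with
  | zero => simp [ColumnSumProcess.run, coverProcess]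
  | succ i ih =>
    rw [run_succ_of_lt S hi]
    have := ih (by omega)
    simp only
    split_ifs <;> omega

lemma sum_run_fst (hk : k ≤ m) {i : ℕ} (hi : i ≤ R) :
    ∑ j, ((coverProcess n m k q D R).run S i).1 j = k * i := by
  induction i with
  | zero => simp [ColumnSumProcess.run, coverProcess]
  | succ i ih =>
    rw [run_succ_of_lt S hi]
    simp only [Finset.sum_add_distrib, Finset.sum_ite_mem, Finset.univ_inter, Finset.sum_const,
      ih (by omega : i ≤ R), (bestSet_spec hk _).1, smul_eq_mul, mul_one]
    ring

/-- In the second phase, the fractional solution stays fixed, and the state holds the best family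
among those evaluated so far. -/
lemma run_add (b : ℕ) :
    ((coverProcess n m k q D R).run S (R + b)).1 = ((coverProcess n m k q D R).run S R).1 ∧
    ((coverProcess n m k q D R).run S (R + b)).2.1.card ≤ k ∧
    ((coverProcess n m k q D R).run S (R + b)).2.2 =
      coverage S ((coverProcess n m k q D R).run S (R + b)).2.1 ∧
    ∀ b' < b, ∀ j, coverage S (candidates k q R ((coverProcess n m k q D R).run S R).1 b' j) ≤
      ((coverProcess n m k q D R).run S (R + b)).2.2 := by
  induction b with
  | zero =>
    rw [add_zero, run_snd_of_le S le_rfl]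
    simp [coverage]
  | succ b ih =>
    obtain ⟨h1, h2, h3, h4⟩ := ih
    generalize ((coverProcess n m k q D R).run S R).1 = x at h1 h4 ⊢
    rw [← add_assoc, ColumnSumProcess.run]
    generalize (coverProcess n m k q D R).run S (R + b) = s at h1 h2 h3 h4 ⊢
    obtain ⟨y, F, v⟩ := s
    simp only at h1 h2 h3 h4
    subst h1
    have hg : (coverProcess n m k q D R).answers S (R + b) (y, F, v) =
        fun j => coverage S (candidates k q R y b j) := funext fun j => answers_add S b _ j
    rw [hg]
    simp only [coverProcess, not_lt.2 (Nat.le_add_right R b), if_false, Nat.add_sub_cancel_left]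
    split_ifs with h
    · refine ⟨rfl, card_candidates_le _ _ _ _ _ _, rfl, fun b' hb' j => ?_⟩
      rcases Nat.lt_succ_iff_lt_or_eq.1 hb' with hb' | rfl
      · exact (h4 b' hb' j).trans h.choose_spec.1.le
      · exact h.choose_spec.2 j
    · refine ⟨rfl, h2, h3, fun b' hb' j => ?_⟩
      rcases Nat.lt_succ_iff_lt_or_eq.1 hb' with hb' | rfl
      · exact h4 b' hb' j
      · have : Nonempty (Fin m) := ⟨j⟩
        obtain ⟨i, -, hi⟩ := Finset.univ.exists_max_image
          (fun j => coverage S (candidates k q R y b' j)) Finset.univ_nonempty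
        by_contra hlt
        exact h ⟨i, (not_le.1 hlt).trans_le (hi j (Finset.mem_univ _)),
          fun l => hi l (Finset.mem_univ _)⟩

/-- The states that can occur. -/
lemma run_mem (i : ℕ) : (coverProcess n m k q D R).run S i ∈
    (Fintype.piFinset fun _ : Fin m => Finset.range (R + 1)) ×ˢ
      (Finset.univ : Finset (Finset (Fin m))) ×ˢ Finset.range (n + 1) := by
  simp only [Finset.mem_product, Fintype.mem_piFinset, Finset.mem_range, Finset.mem_univ,
    true_and, Nat.lt_succ_iff]
  rcases le_total i R with hi | hi
  · refine ⟨fun j => (run_fst_le S hi j).trans hi, ?_⟩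
    rw [run_snd_of_le S hi]
    exact Nat.zero_le n
  · obtain ⟨b, rfl⟩ := Nat.exists_eq_add_of_le hi
    obtain ⟨h1, -, h3, -⟩ := run_add (k := k) (q := q) (D := D) (R := R) S b
    rw [h1, h3]
    exact ⟨run_fst_le S le_rfl, coverage_le S _⟩

/-- The first phase solves the linear relaxation on the elements that lie in at most `D` sets. -/
lemma fractional_coverage (hk : k ≤ m) (hq : 1 ≤ q) (hD : 1 ≤ D) (hR : R = q * D)
    (O : Finset (Fin m)) (hO : O.card = k) :
    (1 - 1 / Real.exp 1 - 2 / q) * ((Finset.univ.filter fun e =>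
        (incidence S e).card ≤ D ∧ ¬ Disjoint (incidence S e) O).card : ℝ) ≤
      ∑ e ∈ Finset.univ.filter fun e => (incidence S e).card ≤ D,
        (1 - Real.exp (-((∑ l ∈ incidence S e,
          ((coverProcess n m k q D R).run S R).1 l : ℕ) / R))) := by
  refine continuous_greedy hq hD hR (incidence S)
    (fun t => ((coverProcess n m k q D R).run S t).1) (fun _ => rfl)
    (fun t => bestSet k ((coverProcess n m k q D R).answers S t
      ((coverProcess n m k q D R).run S t))) ?_ O ?_
  · intro t ht j
    rw [run_succ_of_lt S ht]
  · intro t ht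
    rw [← sum_sum_ite_incidence, ← sum_sum_ite_incidence]
    have h := (bestSet_spec hk ((coverProcess n m k q D R).answers S t
      ((coverProcess n m k q D R).run S t))).2 O hO
    rw [Finset.sum_congr rfl fun j _ => answers_of_lt S ht _ j,
      Finset.sum_congr (rfl : bestSet k _ = _) fun j _ => answers_of_lt S ht _ j] at h
    exact h

end coverProcess

/-! ### The approximation guarantee -/

/-- For `D = q ^ 2 * K` and `m ≤ K * k`, an element with more than `D` sets is missed by the
uniform part of the rounding with probability at most `exp (- q)`. The error is `4 / q` per
element of the union of all sets. -/
lemma coverProcess.coverage_ge {n m k q K R : ℕ} (hm : 1 ≤ m) (hk0 : 1 ≤ k) (hk : k ≤ m)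
    (hq : 1 ≤ q) (hK : 1 ≤ K) (hmk : m ≤ K * k) (hR : R = q * (q ^ 2 * K))
    (S : Fin m → Finset (Fin n)) :
    (1 - 1 / Real.exp 1) * (maxCoverage S k : ℝ) -
        4 / q * ((Finset.univ.filter fun e => (incidence S e).Nonempty).card : ℝ) ≤
      coverage S ((coverProcess n m k q (q ^ 2 * K) R).run S (R + 4 * q ^ 2)).2.1 := by
  classical
  obtain ⟨O, hO, hopt⟩ := exists_coverage_eq_maxCoverage hk S
  have hm0 : (0 : ℝ) < m := by exact_mod_cast hm
  have hq0 : (0 : ℝ) < q := by exact_mod_cast hq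
  have hq1 : 1 / (q : ℝ) ≤ 1 := (div_le_one hq0).2 (by exact_mod_cast hq)
  have hinv0 : 0 ≤ 1 / (q : ℝ) := by positivity
  have hD : 1 ≤ q ^ 2 * K := Nat.mul_pos (pow_pos hq 2) hK
  have hR1 : 1 ≤ R := hR ▸ Nat.mul_pos hq hD
  have hR0 : (0 : ℝ) < R := by exact_mod_cast hR1
  have hfrac := coverProcess.fractional_coverage S hk hq hD hR O hO
  have hround := isRounding_candidates (exists_isRounding hm hk0 hq hR1 _
    (coverProcess.sum_run_fst (q := q) (D := q ^ 2 * K) (R := R) S hk le_rfl))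
  obtain ⟨-, -, hval, hbest⟩ :=
    coverProcess.run_add (k := k) (q := q) (D := q ^ 2 * K) (R := R) S (4 * q ^ 2)
  rw [hval] at hbest
  set D := q ^ 2 * K with hDdef
  generalize ((coverProcess n m k q D R).run S R).1 = x at hfrac hround hbest
  generalize coverage S ((coverProcess n m k q D R).run S (R + 4 * q ^ 2)).2.1 = v at hbest
  generalize candidates k q R x = cand at hround hbest
  set U := Finset.univ.filter fun e => (incidence S e).Nonempty with hU
  set y : Fin n → ℝ := fun e => (∑ l ∈ incidence S e, x l : ℕ) / R with hy
  set X : Fin n → ℝ := fun e =>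
    Real.exp (-((1 - 1 / q) * y e + (incidence S e).card * k / (q * m))) with hX
  have hy0 : ∀ e, 0 ≤ y e := fun e => by positivity
  -- the best family is at least as good as the average
  have havg : ∑ e ∈ U, (1 - X e - 1 / q) ≤ v := by
    have h1 : ∑ b ∈ Finset.range (4 * q ^ 2), ∑ j : Fin m, ∑ e ∈ U,
        (1 - if Disjoint (incidence S e) (cand b j) then (1 : ℝ) else 0) ≤
        ∑ b ∈ Finset.range (4 * q ^ 2), ∑ j : Fin m, (v : ℝ) := by
      refine Finset.sum_le_sum fun b hb => Finset.sum_le_sum fun j _ => ?_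
      have h2 : (coverage S (cand b j) : ℝ) ≤ v := by
        exact_mod_cast hbest b (Finset.mem_range.1 hb) j
      refine le_trans ?_ h2
      rw [coverage_eq_card, Finset.card_filter]
      push_cast
      refine (Finset.sum_le_sum fun e _ => le_of_eq ?_).trans
        (Finset.sum_le_sum_of_subset_of_nonneg U.subset_univ fun e _ _ => ?_)
      · split_ifs <;> simp_all
      · split_ifs <;> norm_num
    have h3 : ∑ b ∈ Finset.range (4 * q ^ 2), ∑ j : Fin m, ∑ e ∈ U,
        (1 - if Disjoint (incidence S e) (cand b j) then (1 : ℝ) else 0) =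
        ∑ e ∈ U, ((4 * q ^ 2 * m : ℝ) - ∑ b ∈ Finset.range (4 * q ^ 2), ∑ j : Fin m,
          if Disjoint (incidence S e) (cand b j) then (1 : ℝ) else 0) := by
      rw [Finset.sum_congr rfl fun b _ => Finset.sum_comm, Finset.sum_comm]
      refine Finset.sum_congr rfl fun e _ => ?_
      simp [Finset.sum_sub_distrib]
    have h4 : ∑ e ∈ U, (1 - X e - 1 / q) * (4 * q ^ 2 * m : ℝ) ≤
        ∑ e ∈ U, ((4 * q ^ 2 * m : ℝ) - ∑ b ∈ Finset.range (4 * q ^ 2), ∑ j : Fin m,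
          if Disjoint (incidence S e) (cand b j) then (1 : ℝ) else 0) := by
      refine Finset.sum_le_sum fun e _ => ?_
      have := hround.2 (incidence S e)
      simp only [hX, hy]
      linarith
    rw [← Finset.sum_mul] at h4
    have h5 : ∑ b ∈ Finset.range (4 * q ^ 2), ∑ j : Fin m, (v : ℝ) = v * (4 * q ^ 2 * m) := by
      simp
      ring
    rw [h3, h5] at h1
    exact le_of_mul_le_mul_right (h4.trans h1) (by positivity)
  have hpoint : ∀ e, (if (incidence S e).card ≤ D then 1 - Real.exp (-y e) else 1) - 1 / q ≤
      1 - X e := by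
    intro e
    split_ifs with he
    · have h1 : X e ≤ Real.exp (-((1 - 1 / q) * y e)) :=
        Real.exp_le_exp.2 (neg_le_neg (le_add_of_nonneg_right (by positivity)))
      have h2 := convexOn_exp.2 (Set.mem_univ 0) (Set.mem_univ (-y e)) hinv0
        (sub_nonneg.2 hq1) (by ring)
      simp only [smul_eq_mul, mul_zero, zero_add, Real.exp_zero, mul_one, mul_neg] at h2
      have h3 := mul_nonneg hinv0 (Real.exp_pos (-y e)).le
      linarith
    · have h1 : q ^ 2 * m ≤ (incidence S e).card * k := by
        calc q ^ 2 * m ≤ q ^ 2 * (K * k) := Nat.mul_le_mul_left _ hmk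
          _ = D * k := by rw [hDdef, mul_assoc]
          _ ≤ _ := Nat.mul_le_mul_right _ (not_le.1 he).le
      have h2 : (q : ℝ) ^ 2 * m ≤ (incidence S e).card * k := by exact_mod_cast h1
      have h3 : (q : ℝ) ≤ (incidence S e).card * k / (q * m) := by
        rw [le_div_iff₀ (by positivity)]
        linarith
      have h4 : X e ≤ Real.exp (-q) :=
        Real.exp_le_exp.2 (neg_le_neg (h3.trans
          (le_add_of_nonneg_left (mul_nonneg (sub_nonneg.2 hq1) (hy0 e)))))
      have h5 : Real.exp (-q) ≤ 1 / q := by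
        rw [Real.exp_neg, ← one_div]
        exact one_div_le_one_div_of_le hq0 (by linarith [Real.add_one_le_exp (q : ℝ)])
      linarith
  have hsum : ∑ e ∈ U, ((if (incidence S e).card ≤ D then 1 - Real.exp (-y e) else 1) : ℝ) =
      ∑ e ∈ Finset.univ.filter fun e => (incidence S e).card ≤ D, (1 - Real.exp (-y e)) +
        ((Finset.univ.filter fun e => ¬ (incidence S e).card ≤ D).card : ℝ) := by
    rw [Finset.sum_subset U.subset_univ, Finset.sum_ite, Finset.sum_const, nsmul_eq_mul, mul_one]
    intro e _ he
    have : incidence S e = ∅ := by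
      simpa [hU, Finset.not_nonempty_iff_eq_empty] using he
    simp [hy, this]
  have hOpt : (maxCoverage S k : ℝ) ≤
      ((Finset.univ.filter fun e =>
        (incidence S e).card ≤ D ∧ ¬ Disjoint (incidence S e) O).card : ℝ) +
        ((Finset.univ.filter fun e => ¬ (incidence S e).card ≤ D).card : ℝ) := by
    rw [← hopt, coverage_eq_card]
    norm_cast
    refine le_trans (Finset.card_le_card fun e he => ?_) (Finset.card_union_le _ _)
    simp only [Finset.mem_union, Finset.mem_filter, Finset.mem_univ, true_and] at he ⊢
    tauto
  have hlowU : ((Finset.univ.filter fun e =>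
        (incidence S e).card ≤ D ∧ ¬ Disjoint (incidence S e) O).card : ℝ) ≤ U.card := by
    norm_cast
    refine Finset.card_le_card fun e he => ?_
    simp only [hU, Finset.mem_filter, Finset.mem_univ, true_and] at he ⊢
    obtain ⟨l, hl, -⟩ := Finset.not_disjoint_iff.1 he.2
    exact ⟨l, hl⟩
  have h1 : ∑ e ∈ U, ((if (incidence S e).card ≤ D then 1 - Real.exp (-y e) else 1) : ℝ) -
      2 / q * U.card ≤ v := by
    refine le_trans (le_of_eq ?_) ((Finset.sum_le_sum fun e _ =>
      sub_le_sub_right (hpoint e) (1 / q)).trans havg)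
    simp only [Finset.sum_sub_distrib, Finset.sum_const, nsmul_eq_mul]
    ring
  rw [hsum] at h1
  generalize ((Finset.univ.filter fun e =>
    (incidence S e).card ≤ D ∧ ¬ Disjoint (incidence S e) O).card : ℝ) = cl at *
  have hhigh : (0 : ℝ) ≤ ((Finset.univ.filter fun e => ¬ (incidence S e).card ≤ D).card : ℝ) :=
    Nat.cast_nonneg _
  generalize ((Finset.univ.filter fun e => ¬ (incidence S e).card ≤ D).card : ℝ) = ch at *
  have he0 : 0 ≤ 1 / Real.exp 1 := by positivity
  have he1 : 0 ≤ 1 - 1 / Real.exp 1 := by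
    rw [sub_nonneg, div_le_one (Real.exp_pos 1)]
    linarith [Real.add_one_le_exp (1 : ℝ)]
  have h2 := mul_le_mul_of_nonneg_left hOpt he1
  have h3 := mul_nonneg he0 hhigh
  have h4 : 2 / q * cl ≤ 2 / q * U.card := mul_le_mul_of_nonneg_left hlowU (by positivity)
  have h5 : 4 / (q : ℝ) * U.card = 2 / q * U.card + 2 / q * U.card := by ring
  have h6 : (1 - 1 / Real.exp 1 - 2 / q) * cl = (1 - 1 / Real.exp 1) * cl - 2 / q * cl := by ring
  rw [h6] at hfrac
  linarith

/-- A sufficiently fine discretization achieves the approximation ratio `1 - 1 / e - ε`. -/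
lemma coverProcess.approx {n m k q K R : ℕ} {ε : ℝ} (hm : 1 ≤ m) (hk0 : 1 ≤ k) (hk : k ≤ m)
    (hq : 1 ≤ q) (hK : 1 ≤ K) (hmk : m ≤ K * k) (hR : R = q * (q ^ 2 * K))
    (hε : 4 * K ≤ ε * q) (S : Fin m → Finset (Fin n)) :
    (1 - 1 / Real.exp 1 - ε) * (maxCoverage S k : ℝ) ≤
      coverage S ((coverProcess n m k q (q ^ 2 * K) R).run S (R + 4 * q ^ 2)).2.1 := by
  have h1 := coverProcess.coverage_ge hm hk0 hk hq hK hmk hR S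
  have hq0 : (0 : ℝ) < q := by exact_mod_cast hq
  have h2 : (Finset.univ.filter fun e => (incidence S e).Nonempty).card ≤ K * maxCoverage S k := by
    refine Nat.le_of_mul_le_mul_left ?_ hk0
    calc _ ≤ m * maxCoverage S k := mul_card_incidence_nonempty_le hm hk S
      _ ≤ K * k * maxCoverage S k := Nat.mul_le_mul_right _ hmk
      _ = _ := by ring
  have h3 : ((Finset.univ.filter fun e => (incidence S e).Nonempty).card : ℝ) ≤
      K * maxCoverage S k := by exact_mod_cast h2
  have h4 : 4 / q * ((Finset.univ.filter fun e => (incidence S e).Nonempty).card : ℝ) ≤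
      ε * maxCoverage S k := by
    rw [div_mul_eq_mul_div, div_le_iff₀ hq0]
    have := mul_le_mul_of_nonneg_right hε (Nat.cast_nonneg (α := ℝ) (maxCoverage S k))
    linarith
  linarith

/-! ### Resource bounds -/

/-- An algorithm whose output is always in `E` has success probability one. -/
lemma MPCAlgorithm.outputProb_eq_one {n m M T : ℕ} (P : MPCAlgorithm n m M T)
    (S : Fin m → Finset (Fin n)) (E : Set (Finset (Fin m))) (h : ∀ ω, P.result S ω ∈ E) :
    P.outputProb S E = 1 := by
  classical
  rw [MPCAlgorithm.outputProb, Finset.filter_true_of_mem fun ω _ => h ω, Finset.card_univ]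
  exact div_self (Nat.cast_ne_zero.2 Fintype.card_ne_zero)

lemma half_le_log {x : ℝ} (hx : 2 ≤ x) : 1 / 2 ≤ Real.log x := by
  have h1 := Real.log_two_gt_d9
  have h2 := Real.log_le_log (by norm_num) hx
  linarith

lemma clog_two_le {x : ℕ} (hx : 1 ≤ x) : (Nat.clog 2 x : ℝ) ≤ 1 + 2 * Real.log x := by
  rcases Nat.lt_or_ge 1 x with h | h
  · have h1 := Nat.pow_pred_clog_lt_self (by norm_num : 1 < 2) h
    have h2 : ((2 : ℝ)) ^ (Nat.clog 2 x).pred ≤ x := by exact_mod_cast h1.le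
    have h3 := Real.log_le_log (by positivity) h2
    rw [Real.log_pow] at h3
    have h4 : (Nat.clog 2 x : ℝ) ≤ (Nat.clog 2 x).pred + 1 := by
      have : Nat.clog 2 x ≤ (Nat.clog 2 x).pred + 1 := by
        rw [Nat.pred_eq_sub_one]
        omega
      exact_mod_cast this
    have h5 := mul_le_mul_of_nonneg_left (half_le_log le_rfl)
      (Nat.cast_nonneg (α := ℝ) (Nat.clog 2 x).pred)
    linarith
  · have : x = 1 := by omega
    subst this
    simp

theorem theorem1 (c : ℝ) (hc : 0 < c) (d : ℕ) :
    ∃ (a : ℕ) (A C : ℝ), ∀ (n m k : ℕ) (ε : ℝ),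
      1 ≤ m → m ≤ n → c * (m : ℝ) ≤ (k : ℝ) → k ≤ m → 0 < ε → ε < 1 →
      ∃ (M T : ℕ) (P : MPCAlgorithm n m M T),
        (M : ℝ) ≤ A * (n : ℝ) * (1 + Real.log (n : ℝ)) ^ a ∧
        (T : ℝ) ≤ C * (1 / ε ^ 3 * Real.log (m : ℝ) *
          (Real.log (1 / ε) + Real.log (m : ℝ))) ∧
        P.RespectsBandwidth ∧
        ∀ S : Fin m → Finset (Fin n),
          1 - 1 / (m : ℝ) ^ d ≤ P.outputProb S
            {F | F.card = k ∧
              (1 - 1 / Real.exp 1 - ε) * (maxCoverage S k : ℝ) ≤ (coverage S F : ℝ)} := by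
  set K := ⌈1 / c⌉₊ with hKdef
  have hK : 1 ≤ K := Nat.one_le_ceil_iff.2 (by positivity)
  have hKc : 1 ≤ K * c := (div_le_iff₀ hc).1 (Nat.le_ceil _)
  have hK1 : (1 : ℝ) ≤ K := by exact_mod_cast hK
  set Z := 126 * K ^ 4 with hZ
  refine ⟨1, 4 * (8 + 2 * Real.log Z), 5500 * K ^ 4, ?_⟩
  intro n m k ε hm hmn hcm hkm hε0 hε1
  have hn : 1 ≤ n := hm.trans hmn
  have hm0 : (0 : ℝ) < m := by exact_mod_cast hm
  have hk0 : 1 ≤ k := by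
    have : (0 : ℝ) < k := (mul_pos hc hm0).trans_le hcm
    exact_mod_cast this
  have hmk : m ≤ K * k := by
    have h1 : (m : ℝ) ≤ K * k := by
      have h2 := mul_le_mul_of_nonneg_left hcm (Nat.cast_nonneg (α := ℝ) K)
      have h3 := mul_le_mul_of_nonneg_right hKc hm0.le
      linarith
    exact_mod_cast h1
  have hlogn : 0 ≤ Real.log n := Real.log_natCast_nonneg n
  have hlogZ : 0 ≤ Real.log Z := Real.log_natCast_nonneg Z
  obtain ⟨pad, hpad⟩ := exists_pad hkm
  -- `b` bits suffice for every number that occurs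
  set b := Nat.clog 2 (Z * n ^ 3) with hbdef
  have hb : Z * n ^ 3 ≤ 2 ^ b := Nat.le_pow_clog (by norm_num) _
  have hn3 : n ≤ n ^ 3 := Nat.le_self_pow (by norm_num) n
  have hK4 : 1 ≤ K ^ 4 := Nat.one_le_pow _ _ hK
  have hn2 : n + 1 ≤ 2 ^ b := by nlinarith
  have hMem : ((4 * n * (1 + b) : ℕ) : ℝ) ≤
      4 * (8 + 2 * Real.log Z) * n * (1 + Real.log n) ^ 1 := by
    have h1 := clog_two_le (x := Z * n ^ 3) (Nat.mul_pos (by positivity) (by positivity))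
    rw [← hbdef] at h1
    push_cast at h1 ⊢
    rw [Real.log_mul (by positivity) (by positivity), Real.log_pow] at h1
    have h2 : 1 + (b : ℝ) ≤ (8 + 2 * Real.log Z) * (1 + Real.log n) := by
      push_cast at h1
      nlinarith [mul_nonneg hlogZ hlogn]
    calc 4 * (n : ℝ) * (1 + b) ≤ 4 * n * ((8 + 2 * Real.log Z) * (1 + Real.log n)) :=
          mul_le_mul_of_nonneg_left h2 (by positivity)
      _ = _ := by ring
  rcases Nat.lt_or_ge 1 m with hm2 | hm1
  swap
  · -- no rounds are allowed for `m = 1`, and none is needed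
    have hmeq : m = 1 := by omega
    subst hmeq
    refine ⟨0, 0, ⟨fun _ _ => Fin.elim0, fun _ _ _ _ _ => [], fun _ _ x _ _ => x, 0,
      fun _ => Finset.univ⟩, ?_, by simp, fun _ _ t => t.elim0, fun S => ?_⟩
    · exact le_trans (by push_cast; positivity) hMem
    · rw [MPCAlgorithm.outputProb_eq_one]
      · simp
      · intro ω
        have hk1 : k = 1 := by omega
        obtain ⟨O, hO, hopt⟩ := exists_coverage_eq_maxCoverage hkm S
        refine ⟨by simp [MPCAlgorithm.result, hk1], ?_⟩
        have h1 : (maxCoverage S k : ℝ) ≤ coverage S Finset.univ := by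
          rw [← hopt]
          exact_mod_cast coverage_mono S O.subset_univ
        have h2 : 0 ≤ 1 / Real.exp 1 := by positivity
        refine le_trans (mul_le_of_le_one_left (Nat.cast_nonneg _) (by linarith)) h1
  have hlogm : 1 / 2 ≤ Real.log m := half_le_log (by exact_mod_cast hm2)
  have hlogε : 0 ≤ Real.log (1 / ε) :=
    Real.log_nonneg ((one_le_div hε0).2 hε1.le)
  have hrounds : ∀ T : ℝ, T ≤ 1375 * K ^ 4 * (1 / ε ^ 3) →
      T ≤ 5500 * K ^ 4 * (1 / ε ^ 3 * Real.log m * (Real.log (1 / ε) + Real.log m)) := by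
    intro T hT
    have h1 : 1 / 4 ≤ Real.log m * (Real.log (1 / ε) + Real.log m) := by nlinarith
    have h2 := mul_le_mul_of_nonneg_left h1
      (by positivity : 0 ≤ 5500 * (K : ℝ) ^ 4 * (1 / ε ^ 3))
    linarith
  have hprob : ∀ {M T : ℕ} (P : MPCAlgorithm n m M T) (out : (Fin m → Finset (Fin n)) →
      Finset (Fin m)), (∀ S ω, P.result S ω = pad (out S)) → (∀ S, (out S).card ≤ k) →
      (∀ S, (1 - 1 / Real.exp 1 - ε) * (maxCoverage S k : ℝ) ≤ coverage S (out S)) →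
      ∀ S : Fin m → Finset (Fin n), 1 - 1 / (m : ℝ) ^ d ≤ P.outputProb S
        {F | F.card = k ∧
          (1 - 1 / Real.exp 1 - ε) * (maxCoverage S k : ℝ) ≤ (coverage S F : ℝ)} := by
    intro M T P out hres hcard happ S
    rw [MPCAlgorithm.outputProb_eq_one]
    · have : 0 ≤ 1 / (m : ℝ) ^ d := by positivity
      linarith
    · intro ω
      obtain ⟨h1, h2⟩ := hpad (out S) (hcard S)
      rw [hres]
      exact ⟨h1, (happ S).trans (by exact_mod_cast coverage_mono S h2)⟩
  have hε3 : 1 / ε ≤ 1 / ε ^ 3 :=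
    one_div_le_one_div_of_le (by positivity) (pow_le_of_le_one hε0.le hε1.le (by norm_num))
  rcases lt_or_ge (ε * m) 1 with hsmall | hlarge
  · -- sequential greedy
    obtain ⟨P, hP, hres⟩ := (greedyProcess n m).exists_mpcAlgorithm hm hmn Finset.univ m b 1
      (4 * n * (1 + b)) k (fun _ _ => Finset.mem_univ _) (by simp)
      (by intro i s e N j; simp only [greedyProcess]; split_ifs <;> omega) (by omega)
      (by nlinarith) pad
    refine ⟨_, _, P, hMem, hrounds _ ?_, hP,
      hprob P (fun S => (greedyProcess n m).run S k) hres
        (fun S => card_greedyProcess_run_le S k) fun S => ?_⟩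
    · have h1 : (m : ℝ) ≤ 1 / ε := by
        rw [le_div_iff₀ hε0]
        linarith
      have h2 : (k : ℝ) ≤ m := by exact_mod_cast hkm
      have h3 : (1 : ℝ) ≤ m := by exact_mod_cast hm
      have h4 : (1 : ℝ) ≤ K ^ 4 := by exact_mod_cast hK4
      have h5 : (0 : ℝ) < 1 / ε ^ 3 := by positivity
      push_cast
      nlinarith
    · refine le_trans ?_ (maxCoverage_le_greedyProcess hk0 hkm S)
      exact mul_le_mul_of_nonneg_right (by linarith) (Nat.cast_nonneg _)
  · -- continuous greedy and rounding
    set q := ⌈4 * K / ε⌉₊ with hqdef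
    have hq : 1 ≤ q := Nat.one_le_ceil_iff.2 (by positivity)
    have hq4 : 4 * K ≤ ε * q := by
      have := (div_le_iff₀ hε0).1 (Nat.le_ceil (4 * K / ε))
      linarith
    have hq5 : (q : ℝ) ≤ 5 * K * (1 / ε) := by
      have h1 := (Nat.ceil_lt_add_one (by positivity : 0 ≤ 4 * (K : ℝ) / ε)).le
      rw [← hqdef] at h1
      have h2 : (1 : ℝ) ≤ 1 / ε := (one_le_div hε0).2 hε1.le
      have h3 : 4 * (K : ℝ) / ε = 4 * K * (1 / ε) := by ring
      rw [h3] at h1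
      nlinarith
    have hqn : q ≤ 5 * K * n := by
      have h1 : 1 / ε ≤ m := by
        rw [div_le_iff₀ hε0]
        linarith
      have h2 : (m : ℝ) ≤ n := by exact_mod_cast hmn
      have h3 : (q : ℝ) ≤ 5 * K * n :=
        hq5.trans (mul_le_mul_of_nonneg_left (h1.trans h2) (by positivity))
      exact_mod_cast h3
    obtain ⟨R, hR⟩ : ∃ R, R = q * (q ^ 2 * K) := ⟨_, rfl⟩
    have hR1 : R + 1 ≤ 2 ^ b := by
      have h1 : R ≤ 125 * K ^ 4 * n ^ 3 := by
        calc R = q ^ 3 * K := by rw [hR]; ring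
          _ ≤ (5 * K * n) ^ 3 * K := Nat.mul_le_mul_right _ (Nat.pow_le_pow_left hqn 3)
          _ = _ := by ring
      have h2 : 1 ≤ K ^ 4 * n ^ 3 := Nat.mul_pos hK4 (pow_pos hn 3)
      have h3 : Z * n ^ 3 = 125 * K ^ 4 * n ^ 3 + K ^ 4 * n ^ 3 := by rw [hZ]; ring
      omega
    have hnq : n * q < 2 ^ b := by
      have h1 : n * q ≤ n ^ 3 * (5 * K ^ 4) := by
        calc n * q ≤ n * (5 * K * n) := Nat.mul_le_mul_left _ hqn
          _ = n ^ 2 * (5 * K) := by ring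
          _ ≤ n ^ 3 * (5 * K ^ 4) := Nat.mul_le_mul (Nat.pow_le_pow_right hn (by norm_num))
              (Nat.mul_le_mul_left _ (Nat.le_self_pow (by norm_num) K))
      have h2 : 1 ≤ K ^ 4 * n ^ 3 := Nat.mul_pos hK4 (pow_pos hn 3)
      have h3 : Z * n ^ 3 = 126 * (K ^ 4 * n ^ 3) := by rw [hZ]; ring
      have h4 : n ^ 3 * (5 * K ^ 4) = 5 * (K ^ 4 * n ^ 3) := by ring
      omega
    obtain ⟨P, hP, hres⟩ := (coverProcess n m k q (q ^ 2 * K) R).exists_mpcAlgorithm hm hmn _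
      (m * b + m + b) b q (4 * n * (1 + b)) (R + 4 * q ^ 2) coverProcess.run_mem
      (by
        simp only [Finset.card_product, Fintype.card_piFinset, Finset.card_range,
          Finset.prod_const, Finset.card_univ, Fintype.card_fin, Fintype.card_finset]
        calc (R + 1) ^ m * (2 ^ m * (n + 1)) ≤ (2 ^ b) ^ m * (2 ^ m * 2 ^ b) :=
              Nat.mul_le_mul (Nat.pow_le_pow_left hR1 m) (Nat.mul_le_mul_left _ hn2)
          _ = 2 ^ (m * b + m + b) := by rw [← pow_mul, pow_add, pow_add]; ring)
      (coverProcess.query_le hq) hnq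
      (by nlinarith [Nat.mul_le_mul_right b hmn, Nat.mul_le_mul_right b hn])
      (fun s => pad s.2.1)
    refine ⟨_, _, P, hMem, hrounds _ ?_, hP,
      hprob P (fun S => ((coverProcess n m k q (q ^ 2 * K) R).run S (R + 4 * q ^ 2)).2.1) hres
        (fun S => (coverProcess.run_add S _).2.1)
        fun S => coverProcess.approx hm hk0 hkm hq hK hmk hR hq4 S⟩
    have h1 : 1 + 2 * (R + 4 * q ^ 2) ≤ 11 * K * q ^ 3 := by
      have h2 : q ^ 2 ≤ K * q ^ 3 := by
        calc q ^ 2 ≤ q ^ 3 := Nat.pow_le_pow_right hq (by norm_num)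
          _ ≤ K * q ^ 3 := Nat.le_mul_of_pos_left _ hK
      have h3 : R = K * q ^ 3 := by rw [hR]; ring
      have h4 : 1 ≤ K * q ^ 3 := Nat.mul_pos hK (pow_pos hq 3)
      have h5 : 11 * K * q ^ 3 = 11 * (K * q ^ 3) := by ring
      omega
    have h2 : ((1 + 2 * (R + 4 * q ^ 2) : ℕ) : ℝ) ≤ 11 * K * q ^ 3 := by exact_mod_cast h1
    refine h2.trans ?_
    calc 11 * (K : ℝ) * q ^ 3 ≤ 11 * K * (5 * K * (1 / ε)) ^ 3 :=
          mul_le_mul_of_nonneg_left (pow_le_pow_left₀ (Nat.cast_nonneg _) hq5 3) (by positivity)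
      _ = 1375 * K ^ 4 * (1 / ε ^ 3) := by
          rw [mul_pow, one_div_pow]
          ring
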